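/- Let $n\ge 1$ and let $\mathcal{PT}_n$ be the monoid of all partial maps from $\{1,\dots,n\}$ to itself, under composition of maps written on the right (the left factor acts first). For $\alpha\in\mathcal{PT}_n$, $\operatorname{rank}(\alpha)=|\operatorname{im}(\alpha)|$ and $\ker(\alpha)=\{(i,j)\in\operatorname{dom}(\alpha)^2 : i\alpha=j\alpha\}$. Let $\mathcal{POD}_n$ be the submonoid of those $\alpha\in\mathcal{PT}_n$ that are order-preserving ($i\le j\Rightarrow i\alpha\le j\alpha$ for all $i,j\in\operatorname{dom}(\alpha)$) or order-reversing ($i\le j\Rightarrow i\alpha\ge j\alpha$ for all $i,j\in\operatorname{dom}(\alpha)$), and let $\gamma_n\in\mathcal{POD}_n$ be the permutation $i\mapsto n-i+1$. A maximal subsemigroup of a semigroup $S$ is a proper subsemigroup of $S$ that is contained in no other proper subsemigroup of $S$. Elements $x,y\in S$ are $\mathscr{R}$-related if $xS\cup\{x\}=yS\cup\{y\}$; an $\mathscr{R}$-class is an equivalence class of this relation. For $n\ge2$ put $$J_{n-1}=\{\alpha\in\mathcal{PT}_n:\operatorname{rank}(\alpha)=n-1\},\qquad L_i=\{\alpha\in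 J_{n-1}: i\notin\operatorname{im}(\alpha)\},$$ $$R_i=\{\alpha\in J_{n-1}: i\notin\operatorname{dom}(\alpha)\},\qquad R_{\{i,j\}}=\{\alpha\in J_{n-1}:(i,j)\in\ker(\alpha)\}\quad(i\neq j).$$ **Theorem.** Let $n\ge2$. The maximal subsemigroups of $\mathcal{POD}_n$ are exactly the following sets: (a) $\mathcal{POD}_n\setminus\{\gamma_n\}$; (b) for each non-empty proper subset $A$ of $\{1,\dots,\lceil n/2\rceil\}$, the union of $\mathcal{POD}_n\setminus J_{n-1}$ and of the sets - $(L_i\cup L_{n-i+1})\cap\mathcal{POD}_n$ for $i\in A$, - $(R_i\cup R_{n-i+1})\cap\mathcal{POD}_n$ for $i\in\{1,\dots,\lceil n/2\rceil\}$ with $i\notin A$, - $(R_{\{i,i+1\}}\cup R_{\{n-i,n-i+1\}})\cap\mathcal{POD}_n$ for $i\in\{1,\dots,\lfloor n/2\rfloor\}$ with $i\notin A$ and $i+1\notin A$; (c) $\mathcal{POD}_n\setminus(R\cup\gamma_nR)$, where $R$ is any $\mathscr{R}$-class of $\mathcal{POD}_n$ contained in $J_{n-1}\cap\mathcal{POD}_n$.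 Moreover, the sets in (c) are exactly the sets (i) $\mathcal{POD}_n\setminus(R_i\cup R_{n-i+1})$ for $i\in\{1,\dots,\lceil n/2\rceil\}$, and (ii) $\mathcal{POD}_n\setminus(R_{\{i,i+1\}}\cup R_{\{n-i,n-i+1\}})$ for $i\in\{1,\dots,\lfloor n/2\rfloor\}$. The monoid $\mathcal{POD}_1=\mathcal{PT}_1$ is a semilattice (a commutative semigroup of idempotents) of order $2$, and its maximal subsemigroups are exactly its singleton subsets. For every $n\ge1$, the number of maximal subsemigroups of $\mathcal{POD}_n$ is $2^{\lceil n/2\rceil}+n-1$. -/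

import Mathlib

namespace PartialTrans

/-- Partial transformations of degree `n`. The point `x : Fin n` stands for the number `x + 1` of
`{1, …, n}`, and `α x = none` means that `α` is undefined at that point. -/
def PT (n : ℕ) : Type := Fin n → Option (Fin n)

/-- Composition as binary relations: the image of `x` under `α * β` is `(x α) β`, so the left
factor acts first. -/
instance instMonoidPT (n : ℕ) : Monoid (PT n) where
  mul α β := fun x => (α x).bind β
  one := fun x => some x
  mul_assoc α β δ := by
    funext x
    change ((α x).bind β).bind δ = (α x).bind (fun y => (β y).bind δ)
    exact Option.bind_assoc _ _ _
  one_mul α := by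
    funext x
    rfl
  mul_one α := by
    funext x
    change (α x).bind some = α x
    cases α x <;> rfl

theorem mul_eq_some {n : ℕ} (α β : PT n) (x z : Fin n) :
    (α * β) x = some z ↔ ∃ y, α x = some y ∧ β y = some z :=
  Option.bind_eq_some_iff

def dom {n : ℕ} (α : PT n) : Set (Fin n) := {x | ∃ y, α x = some y}

def im {n : ℕ} (α : PT n) : Set (Fin n) := {y | ∃ x, α x = some y}

noncomputable def rank {n : ℕ} (α : PT n) : ℕ := (im α).ncard

/-- The kernel of `α`, as a set of pairs of points of its domain. -/
def ker {n : ℕ} (α : PT n) : Set (Fin n × Fin n) := {p | ∃ z, α p.1 = some z ∧ α p.2 = some z}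

def OrderPreserving {n : ℕ} (α : PT n) : Prop :=
  ∀ x y a b : Fin n, α x = some a → α y = some b → x ≤ y → a ≤ b

def OrderReversing {n : ℕ} (α : PT n) : Prop :=
  ∀ x y a b : Fin n, α x = some a → α y = some b → x ≤ y → b ≤ a

/-- The monoid of order-preserving or order-reversing partial transformations of degree `n`. -/
def POD (n : ℕ) : Submonoid (PT n) where
  carrier := {α | OrderPreserving α ∨ OrderReversing α}
  one_mem' := by
    left
    intro x y a b hx hy h
    obtain rfl : x = a := Option.some.inj hx
    obtain rfl : y = b := Option.some.inj hy
    exact h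
  mul_mem' := by
    intro α β hα hβ
    rcases hα with hα | hα <;> rcases hβ with hβ | hβ
    · left
      intro x y a b hx hy h
      obtain ⟨x', hx1, hx2⟩ := (mul_eq_some α β x a).1 hx
      obtain ⟨y', hy1, hy2⟩ := (mul_eq_some α β y b).1 hy
      exact hβ _ _ _ _ hx2 hy2 (hα _ _ _ _ hx1 hy1 h)
    · right
      intro x y a b hx hy h
      obtain ⟨x', hx1, hx2⟩ := (mul_eq_some α β x a).1 hx
      obtain ⟨y', hy1, hy2⟩ := (mul_eq_some α β y b).1 hy
      exact hβ _ _ _ _ hx2 hy2 (hα _ _ _ _ hx1 hy1 h)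
    · right
      intro x y a b hx hy h
      obtain ⟨x', hx1, hx2⟩ := (mul_eq_some α β x a).1 hx
      obtain ⟨y', hy1, hy2⟩ := (mul_eq_some α β y b).1 hy
      exact hβ _ _ _ _ hy2 hx2 (hα _ _ _ _ hx1 hy1 h)
    · left
      intro x y a b hx hy h
      obtain ⟨x', hx1, hx2⟩ := (mul_eq_some α β x a).1 hx
      obtain ⟨y', hy1, hy2⟩ := (mul_eq_some α β y b).1 hy
      exact hβ _ _ _ _ hy2 hx2 (hα _ _ _ _ hx1 hy1 h)

/-- The permutation `γ_n` reversing the order of `{1, …, n}`. -/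
def γ (n : ℕ) : POD n :=
  ⟨fun x => some x.rev, by
    right
    intro x y a b hx hy h
    obtain rfl : x.rev = a := Option.some.inj hx
    obtain rfl : y.rev = b := Option.some.inj hy
    exact Fin.rev_le_rev.2 h⟩

/-- The partial transformations of degree `n` and rank `n - 1` (used for `n ≥ 2`). -/
def J (n : ℕ) : Set (PT n) := {α | rank α = n - 1}

/-- `L_i = {α ∈ J_{n-1} : i ∉ im α}` for `i ∈ {1, …, n}`. -/
def L (n i : ℕ) : Set (PT n) := {α | α ∈ J n ∧ ∀ x : Fin n, (x : ℕ) + 1 = i → x ∉ im α}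

/-- `R_i = {α ∈ J_{n-1} : i ∉ dom α}` for `i ∈ {1, …, n}`. -/
def R (n i : ℕ) : Set (PT n) := {α | α ∈ J n ∧ ∀ x : Fin n, (x : ℕ) + 1 = i → x ∉ dom α}

/-- `R_{i,j} = {α ∈ J_{n-1} : (i, j) ∈ ker α}` for distinct `i, j ∈ {1, …, n}`. -/
def RPair (n i j : ℕ) : Set (PT n) :=
  {α | α ∈ J n ∧ ∃ x y : Fin n, (x : ℕ) + 1 = i ∧ (y : ℕ) + 1 = j ∧ (x, y) ∈ ker α}

/-- A set is a maximal subsemigroup of `S` if it is a proper subsemigroup that is contained in no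
other proper subsemigroup. -/
def IsMaximalSubsemigroup {S : Type*} [Semigroup S] (X : Set S) : Prop :=
  ∃ T : Subsemigroup S, IsCoatom T ∧ (T : Set S) = X

/-- The principal right ideal `xS ∪ {x}`. -/
def principalRightIdeal {S : Type*} [Semigroup S] (x : S) : Set S := {y | y = x ∨ ∃ s, y = x * s}

/-- Green's `R`-relation. -/
def GreenR {S : Type*} [Semigroup S] (x y : S) : Prop :=
  principalRightIdeal x = principalRightIdeal y

def IsRClass {S : Type*} [Semigroup S] (C : Set S) : Prop := ∃ x, C = {y | GreenR y x}

/-- The rectangle-type subset of `POD n` given by a set `A` of indices from `{1, …, ⌈n/2⌉}`,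
where `⌈n/2⌉ = (n + 1) / 2` and `⌊n/2⌋ = n / 2` in natural-number division. -/
def rectangle (n : ℕ) (A : Finset ℕ) : Set (POD n) :=
  {α | (α : PT n) ∉ J n ∨
    (∃ i ∈ A, (α : PT n) ∈ L n i ∪ L n (n - i + 1)) ∨
    (∃ i ∈ Finset.Icc 1 ((n + 1) / 2), i ∉ A ∧ (α : PT n) ∈ R n i ∪ R n (n - i + 1)) ∨
    (∃ i ∈ Finset.Icc 1 (n / 2), i ∉ A ∧ i + 1 ∉ A ∧
      (α : PT n) ∈ RPair n i (i + 1) ∪ RPair n (n - i) (n - i + 1))}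

/-- `X = POD_n \ (C ∪ γ_n C)` for some Green's `R`-class `C` of `POD_n` of elements of rank
`n - 1`. -/
def IsRemoveROrbit (n : ℕ) (X : Set (POD n)) : Prop :=
  ∃ C : Set (POD n), IsRClass C ∧ (∀ α ∈ C, (α : PT n) ∈ J n) ∧
    X = (C ∪ (fun α => γ n * α) '' C)ᶜ

end PartialTrans

namespace PartialTrans

/-! ### Ranks of products -/

/-! Write n = m + 1. An element of rank m is determined by its kernel r (one point missing, or two
neighbours glued), the point l missing from its image, and a sign s for preserving or reversing
order; this is `elt r l s` (`exists_eq_elt`). The product of `elt r l s` and `elt r' l' s'` has rank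
m exactly when the complement of l is a transversal of r' (`Compat l r'`), and is then `elt r l' (s
^^ s')`. Multiplying by the reversal γ on the left reverses r, on the right reverses l, and both
change the sign. The only elements of larger rank are 1 and γ.

These elements together with γ generate the monoid (`eq_top_of_J_subset`), so a proper subsemigroup
T containing γ must omit something of rank m. Either T misses a whole row r, hence also the reversed
row, and lies in `rowCompl r`; or it meets every row. In the latter case `exists_subset_rect` looks
at the set X of columns in which T meets a fixed row r. If an element of T has row r' and column l',
and some column of X is compatible with r', then multiplication puts l' into X; thus T lies in `rect
X`. If X were everything for every r, then T would contain all of rank m up to sign, and the middle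
glued row supplies both signs, a contradiction.

Conversely, the same lemma shows that a proper subsemigroup above a rectangle lies in another
rectangle, which must be equal to the first (`eq_of_rect_subset`), and that one strictly above a row
complement would put the row complement inside a rectangle, which is impossible
(`not_rowCompl_subset_rect`). A subsemigroup avoiding γ lies in `γCompl`. What remains is to
identify rows with R-classes and to encode reversal-invariant sets of columns by their
representatives in {1, …, ⌈n/2⌉}. -/

theorem mul_apply {n : ℕ} (α β : PT n) (x : Fin n) : (α * β) x = (α x).bind β := rfl

theorem im_mul_subset {n : ℕ} (α β : PT n) : im (α * β) ⊆ im β := by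
  rintro z ⟨x, hx⟩
  obtain ⟨y, -, hy⟩ := (mul_eq_some α β x z).1 hx
  exact ⟨y, hy⟩

theorem some_image_im_mul_subset {n : ℕ} (α β : PT n) : some '' im (α * β) ⊆ β '' im α := by
  rintro _ ⟨z, ⟨x, hx⟩, rfl⟩
  obtain ⟨y, hy, hz⟩ := (mul_eq_some α β x z).1 hx
  exact ⟨y, ⟨x, hy⟩, hz⟩

theorem ncard_some_image {n : ℕ} (s : Set (Fin n)) : (some '' s).ncard = s.ncard :=
  Set.ncard_image_of_injective _ (Option.some_injective _)

theorem rank_mul_le_right {n : ℕ} (α β : PT n) : rank (α * β) ≤ rank β :=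
  Set.ncard_le_ncard (im_mul_subset α β) (Set.toFinite _)

theorem rank_mul_le_left {n : ℕ} (α β : PT n) : rank (α * β) ≤ rank α := by
  have h1 := Set.ncard_le_ncard (some_image_im_mul_subset α β) (Set.toFinite _)
  have h2 : (β '' im α).ncard ≤ (im α).ncard := Set.ncard_image_le (Set.toFinite _)
  rw [ncard_some_image] at h1
  exact h1.trans h2

theorem rank_le {n : ℕ} (α : PT n) : rank α ≤ n := by
  have := Set.ncard_le_ncard (Set.subset_univ (im α)) (Set.toFinite _)
  simpa [rank, Set.ncard_univ] using this

/-- If multiplying by `β` does not lower the rank of `α`, then `β` is defined and injective on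
the image of `α`. -/
theorem injOn_of_rank_mul_eq {n : ℕ} {α β : PT n} (h : rank (α * β) = rank α) :
    Set.InjOn β (im α) ∧ ∀ y ∈ im α, β y ≠ none := by
  have h1 := some_image_im_mul_subset α β
  have h2 : (β '' im α).ncard ≤ (im α).ncard := Set.ncard_image_le (Set.toFinite _)
  have h3 : (β '' im α).ncard ≤ (some '' im (α * β)).ncard := by
    rw [ncard_some_image]
    exact h2.trans h.ge
  -- By counting, the values of `β` on the image are exactly the defined values of the product, so
  -- `none` is not among them.
  have h4 := Set.eq_of_subset_of_ncard_le h1 h3 (Set.toFinite _)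
  refine ⟨Set.injOn_of_ncard_image_eq ?_ (Set.toFinite _), ?_⟩
  · rw [← h4, ncard_some_image]
    exact h
  · intro y hy hn
    have : β y ∈ some '' im (α * β) := h4 ▸ ⟨y, hy, rfl⟩
    obtain ⟨z, -, hz⟩ := this
    rw [hn] at hz
    cases hz

/-- A partial map attaining as many values as it has arguments is total and injective. -/
theorem exists_total_of_ncard {k n : ℕ} (f : Fin k → Option (Fin n))
    (h : {y | ∃ x, f x = some y}.ncard = k) :
    ∃ g : Fin k → Fin n, Function.Injective g ∧ (∀ x, f x = some (g x)) ∧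
      Set.range g = {y | ∃ x, f x = some y} := by
  have h1 : some '' {y | ∃ x, f x = some y} ⊆ f '' Set.univ := by
    rintro _ ⟨y, ⟨x, hx⟩, rfl⟩
    exact ⟨x, trivial, hx⟩
  have hu : (Set.univ : Set (Fin k)).ncard = k := by simp [Set.ncard_univ]
  have h2 : (f '' Set.univ).ncard ≤ k :=
    (Set.ncard_image_le (Set.toFinite _)).trans hu.le
  have h4 := Set.eq_of_subset_of_ncard_le h1
    (by rw [ncard_some_image, h]; exact h2) (Set.toFinite _)
  have hinj : Set.InjOn f Set.univ := by
    refine Set.injOn_of_ncard_image_eq ?_ (Set.toFinite _)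
    rw [← h4, ncard_some_image, h, hu]
  have ht : ∀ x, ∃ y, f x = some y := by
    intro x
    have : f x ∈ some '' {y | ∃ x, f x = some y} := h4 ▸ ⟨x, trivial, rfl⟩
    obtain ⟨y, -, hy⟩ := this
    exact ⟨y, hy.symm⟩
  choose g hg using ht
  refine ⟨g, ?_, hg, ?_⟩
  · intro x y hxy
    exact hinj trivial trivial (by rw [hg, hg, hxy])
  · ext y
    constructor
    · rintro ⟨x, rfl⟩
      exact ⟨x, hg x⟩
    · rintro ⟨x, hx⟩
      exact ⟨x, Option.some.inj ((hg x).symm.trans hx)⟩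

/-! ### Reversal by a sign -/

/-- The identity or the reversal of `Fin m`. -/
def flip {m : ℕ} (s : Bool) (x : Fin m) : Fin m := if s then x.rev else x

theorem flip_flip {m : ℕ} (s t : Bool) (x : Fin m) : flip s (flip t x) = flip (s ^^ t) x := by
  cases s <;> cases t <;> simp [flip]

theorem flip_involutive {m : ℕ} (s : Bool) : Function.Involutive (flip s : Fin m → Fin m) := by
  intro x
  rw [flip_flip]
  simp [flip]

theorem flip_mono {m : ℕ} (s : Bool) :
    Monotone (flip s : Fin m → Fin m) ∨ Antitone (flip s : Fin m → Fin m) := by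
  cases s
  · exact Or.inl fun x y h => h
  · exact Or.inr fun x y h => Fin.rev_le_rev.2 h

/-- Two injective maps out of a chain, the first monotone or antitone, the second strictly
monotone, agree up to reversal if they have the same range. -/
theorem exists_flip_of_range_eq {k n : ℕ} {g e : Fin k → Fin n} (hg : Function.Injective g)
    (hm : Monotone g ∨ Antitone g) (he : StrictMono e) (hr : Set.range g = Set.range e) :
    ∃ s, ∀ x, g x = e (flip s x) := by
  rcases hm with hm | hm
  · refine ⟨false, fun x => ?_⟩
    rw [(StrictMono.range_inj (hm.strictMono_of_injective hg) he).1 hr]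
    rfl
  · refine ⟨true, fun x => ?_⟩
    have h1 : StrictMono (fun x : Fin k => g x.rev) := by
      intro x y h
      exact hm.strictAnti_of_injective hg (Fin.rev_lt_rev.2 h)
    have h2 : Set.range (fun x : Fin k => g x.rev) = Set.range e := by
      rw [← hr]
      exact Fin.rev_surjective.range_comp g
    have h3 := congrFun ((StrictMono.range_inj h1 he).1 h2) x.rev
    simpa [flip] using h3

/-! ### Normal form of the elements of rank `n - 1` -/

/-- The possible kernels of elements of `POD (m + 1)` of rank `m`: either one point is missing
from the domain, or two neighbouring points are identified. -/
inductive RowIndex (m : ℕ) : Type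
  | miss (i : Fin (m + 1)) : RowIndex m
  | glue (i : Fin m) : RowIndex m

namespace RowIndex

variable {m : ℕ}

/-- The order-preserving partial surjection onto `Fin m` with the given kernel. -/
def proj : RowIndex m → Fin (m + 1) → Option (Fin m)
  | miss i, x => finSuccEquiv' i x
  | glue i, x => some (i.predAbove x)

def rev : RowIndex m → RowIndex m
  | miss i => miss i.rev
  | glue i => glue i.rev

/-- `Compat l r` says that the complement of `l` is a transversal of the kernel `r`. -/
def Compat (l : Fin (m + 1)) : RowIndex m → Prop
  | miss i => l = i
  | glue i => l = i.castSucc ∨ l = i.succ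

theorem rev_rev (r : RowIndex m) : r.rev.rev = r := by
  cases r <;> simp [rev]

theorem compat_rev {l : Fin (m + 1)} {r : RowIndex m} : Compat l.rev r.rev ↔ Compat l r := by
  cases r with
  | miss i => simp [Compat, rev]
  | glue i =>
    simp only [Compat, rev, ← Fin.rev_succ, ← Fin.rev_castSucc, Fin.rev_inj]
    tauto

theorem exists_compat (r : RowIndex m) : ∃ l, Compat l r := by
  cases r with
  | miss i => exact ⟨i, rfl⟩
  | glue i => exact ⟨i.castSucc, Or.inl rfl⟩

theorem proj_succAbove {l : Fin (m + 1)} {r : RowIndex m} (h : Compat l r) (j : Fin m) :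
    r.proj (l.succAbove j) = some j := by
  cases r with
  | miss i =>
    obtain rfl : l = i := h
    exact finSuccEquiv'_succAbove l j
  | glue i =>
    rcases h with rfl | rfl
    · exact congrArg some (Fin.predAbove_succAbove i j)
    · refine congrArg some ?_
      have h := Fin.succ_succAbove_predAbove (p := i) (Fin.succAbove_ne i.succ j)
      exact Fin.succAbove_right_injective h

/-- If compatibility fails, the complement of `l` contains either the point where the projection is
undefined or both of the glued neighbours. This is the converse of `proj_succAbove`. -/
theorem compat_of_injective {l : Fin (m + 1)} {r : RowIndex m}
    (h1 : ∀ x, x ≠ l → r.proj x ≠ none) (h2 : ∀ x y, x ≠ l → y ≠ l → r.proj x = r.proj y → x = y) :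
    Compat l r := by
  cases r with
  | miss i =>
    by_contra h
    exact h1 i (Ne.symm h) (finSuccEquiv'_at i)
  | glue i =>
    by_contra h
    simp only [Compat, not_or] at h
    have := h2 i.castSucc i.succ (Ne.symm h.1) (Ne.symm h.2) (by simp [proj])
    exact (Fin.castSucc_lt_succ (i := i)).ne this

theorem proj_rev (r : RowIndex m) (x : Fin (m + 1)) :
    r.proj x.rev = (r.rev.proj x).map Fin.rev := by
  cases r with
  | miss i =>
    rcases eq_or_ne x i.rev with rfl | h
    · simp [proj, rev]
    · obtain ⟨j, rfl⟩ := Fin.exists_succAbove_eq h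
      simp only [proj, rev, finSuccEquiv'_succAbove]
      rw [Fin.rev_succAbove, Fin.rev_rev, finSuccEquiv'_succAbove]
      rfl
  | glue i =>
    simp [proj, rev, Fin.predAbove_rev_left]

theorem proj_mono (r : RowIndex m) {x y : Fin (m + 1)} {a b : Fin m} (hx : r.proj x = some a)
    (hy : r.proj y = some b) (h : x ≤ y) : a ≤ b := by
  cases r with
  | miss i =>
    rcases eq_or_ne x i with rfl | hxi
    · simp [proj] at hx
    rcases eq_or_ne y i with rfl | hyi
    · simp [proj] at hy
    obtain ⟨j, rfl⟩ := Fin.exists_succAbove_eq hxi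
    obtain ⟨k, rfl⟩ := Fin.exists_succAbove_eq hyi
    simp only [proj, finSuccEquiv'_succAbove, Option.some.injEq] at hx hy
    subst hx hy
    exact Fin.succAbove_le_succAbove_iff.1 h
  | glue i =>
    simp only [proj, Option.some.injEq] at hx hy
    subst hx hy
    exact Fin.predAbove_right_monotone i h

theorem proj_eq_none {r : RowIndex m} {x : Fin (m + 1)} : r.proj x = none ↔ r = miss x := by
  cases r with
  | miss i =>
    rcases eq_or_ne x i with rfl | h
    · simp [proj]
    · obtain ⟨j, rfl⟩ := Fin.exists_succAbove_eq h
      simp [proj, (Fin.succAbove_ne i j).symm]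
  | glue i => simp [proj]

theorem proj_eq_some_both {r : RowIndex m} {a : Fin m} :
    (∃ z, r.proj a.castSucc = some z ∧ r.proj a.succ = some z) ↔ r = glue a := by
  constructor
  · rintro ⟨z, h1, h2⟩
    cases r with
    | miss i =>
      have := (finSuccEquiv' i).injective (h1.trans h2.symm)
      exact absurd this (Fin.castSucc_lt_succ (i := a)).ne
    | glue i =>
      simp only [proj, Option.some.injEq] at h1 h2
      congr 1
      have h3 := h1.trans h2.symm
      rcases lt_trichotomy i a with h | h | h
      · rw [Fin.predAbove_of_castSucc_lt _ _ (Fin.castSucc_lt_castSucc_iff.2 h),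
          Fin.predAbove_of_castSucc_lt _ _ ((Fin.castSucc_lt_succ_iff).2 h.le)] at h3
        have := congrArg Fin.val h3
        simp at this
        omega
      · exact h
      · rw [Fin.predAbove_of_le_castSucc _ _ (Fin.castSucc_le_castSucc_iff.2 h.le),
          Fin.predAbove_of_le_castSucc _ _ (Fin.succ_le_castSucc_iff.2 h)] at h3
        have := congrArg Fin.val h3
        simp at this
  · rintro rfl
    exact ⟨a, by simp [proj], by simp [proj]⟩

end RowIndex

open RowIndex

variable {m : ℕ}

/-- The element of `POD (m + 1)` of rank `m` with kernel `r` and image the complement of `l`,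
which is order-preserving or order-reversing according to the sign `s`. -/
def elt (r : RowIndex m) (l : Fin (m + 1)) (s : Bool) : POD (m + 1) :=
  ⟨fun x => (r.proj x).map (fun j => l.succAbove (flip s j)), by
    have key : ∀ x a, (r.proj x).map (fun j => l.succAbove (flip s j)) = some a →
        ∃ j, r.proj x = some j ∧ l.succAbove (flip s j) = a := fun x a h =>
      Option.map_eq_some_iff.1 h
    rcases flip_mono (m := m) s with hs | hs
    · left
      intro x y a b hx hy h
      obtain ⟨i, hi, rfl⟩ := key x a hx
      obtain ⟨j, hj, rfl⟩ := key y b hy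
      exact Fin.succAbove_le_succAbove_iff.2 (hs (r.proj_mono hi hj h))
    · right
      intro x y a b hx hy h
      obtain ⟨i, hi, rfl⟩ := key x a hx
      obtain ⟨j, hj, rfl⟩ := key y b hy
      exact Fin.succAbove_le_succAbove_iff.2 (hs (r.proj_mono hi hj h))⟩

theorem elt_apply (r : RowIndex m) (l : Fin (m + 1)) (s : Bool) (x : Fin (m + 1)) :
    (elt r l s : PT (m + 1)) x = (r.proj x).map (fun j => l.succAbove (flip s j)) := rfl

theorem elt_eq_none {r : RowIndex m} {l : Fin (m + 1)} {s : Bool} {x : Fin (m + 1)} :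
    (elt r l s : PT (m + 1)) x = none ↔ r.proj x = none := by
  rw [elt_apply, Option.map_eq_none_iff]

theorem elt_eq_iff {r : RowIndex m} {l : Fin (m + 1)} {s : Bool} {x y : Fin (m + 1)} :
    (elt r l s : PT (m + 1)) x = (elt r l s : PT (m + 1)) y ↔ r.proj x = r.proj y := by
  rw [elt_apply, elt_apply]
  refine (Option.map_injective ?_).eq_iff
  exact Fin.succAbove_right_injective.comp (flip_involutive s).injective

theorem im_elt (r : RowIndex m) (l : Fin (m + 1)) (s : Bool) :
    im (elt r l s : PT (m + 1)) = {l}ᶜ := by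
  rw [← Fin.range_succAbove]
  ext y
  constructor
  · rintro ⟨x, hx⟩
    obtain ⟨j, -, rfl⟩ := Option.map_eq_some_iff.1 hx
    exact ⟨_, rfl⟩
  · rintro ⟨j, rfl⟩
    obtain ⟨l', hl'⟩ := r.exists_compat
    refine ⟨l'.succAbove (flip s j), ?_⟩
    rw [elt_apply, proj_succAbove hl', Option.map_some, flip_involutive s]

theorem ncard_compl_singleton (l : Fin (m + 1)) : ({l}ᶜ : Set (Fin (m + 1))).ncard = m := by
  rw [Set.ncard_compl, Set.ncard_singleton]
  simp

theorem elt_mem_J (r : RowIndex m) (l : Fin (m + 1)) (s : Bool) :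
    (elt r l s : PT (m + 1)) ∈ J (m + 1) := by
  change rank _ = _
  rw [rank, im_elt, ncard_compl_singleton]
  rfl

/-- The image gives the column; the undefined points and the coincidences of values give the row.
The sign cannot be recovered in general: for m ≤ 1 both signs give the same map. -/
theorem elt_inj {r r' : RowIndex m} {l l' : Fin (m + 1)} {s s' : Bool}
    (h : elt r l s = elt r' l' s') : r = r' ∧ l = l' := by
  have hl : l = l' := by
    have := congrArg (fun α : POD (m + 1) => im (α : PT (m + 1))) h
    simpa [im_elt] using this
  refine ⟨?_, hl⟩
  have hn : ∀ x, r.proj x = none ↔ r'.proj x = none := fun x => by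
    rw [← elt_eq_none (l := l) (s := s), h, elt_eq_none]
  have he : ∀ x y, r.proj x = r.proj y ↔ r'.proj x = r'.proj y := fun x y => by
    rw [← elt_eq_iff (l := l) (s := s), h, elt_eq_iff]
  cases r with
  | miss i => exact (proj_eq_none.1 ((hn i).1 (proj_eq_none.2 rfl))).symm
  | glue i =>
    cases r' with
    | miss j => exact proj_eq_none.1 ((hn j).2 (proj_eq_none.2 rfl))
    | glue j =>
      have := (he i.castSucc i.succ).1 (by simp [proj])
      exact (proj_eq_some_both.1 ⟨_, this, rfl⟩).symm

theorem elt_mul_elt {r r' : RowIndex m} {l l' : Fin (m + 1)} {s s' : Bool} (h : Compat l r') :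
    elt r l s * elt r' l' s' = elt r l' (s ^^ s') := by
  refine Subtype.ext (funext fun x => ?_)
  change ((r.proj x).map _).bind _ = (r.proj x).map _
  rcases r.proj x with _ | j
  · rfl
  · change (elt r' l' s' : PT (m + 1)) (l.succAbove (flip s j)) = some _
    rw [elt_apply, proj_succAbove h, Option.map_some, flip_flip, Bool.xor_comm]

/-- Since no rank is lost, the right factor is defined and injective on the image of the left one,
the complement of `l`. -/
theorem compat_of_mul_mem_J {r r' : RowIndex m} {l l' : Fin (m + 1)} {s s' : Bool}
    (h : ((elt r l s * elt r' l' s' : POD (m + 1)) : PT (m + 1)) ∈ J (m + 1)) : Compat l r' := by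
  have h' : rank ((elt r l s : PT (m + 1)) * (elt r' l' s' : PT (m + 1))) =
      rank (elt r l s : PT (m + 1)) :=
    Eq.trans h (elt_mem_J r l s).symm
  obtain ⟨h1, h2⟩ := injOn_of_rank_mul_eq h'
  rw [im_elt] at h1 h2
  refine compat_of_injective (fun x hx hn => h2 x hx (elt_eq_none.2 hn)) ?_
  intro x y hx hy hxy
  exact h1 hx hy (elt_eq_iff.2 hxy)

theorem γ_apply (n : ℕ) (x : Fin n) : (γ n : PT n) x = some x.rev := rfl

theorem γ_mul_γ (n : ℕ) : γ n * γ n = 1 := by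
  refine Subtype.ext (funext fun x => ?_)
  change some x.rev.rev = some x
  rw [Fin.rev_rev]

theorem γ_mul_elt (r : RowIndex m) (l : Fin (m + 1)) (s : Bool) :
    γ (m + 1) * elt r l s = elt r.rev l (!s) := by
  refine Subtype.ext (funext fun x => ?_)
  change (r.proj x.rev).map _ = (r.rev.proj x).map _
  rw [proj_rev, Option.map_map]
  congr 1
  funext j
  cases s <;> simp [flip]

theorem elt_mul_γ (r : RowIndex m) (l : Fin (m + 1)) (s : Bool) :
    elt r l s * γ (m + 1) = elt r l.rev (!s) := by
  refine Subtype.ext (funext fun x => ?_)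
  change ((r.proj x).map _).bind _ = (r.proj x).map _
  rcases r.proj x with _ | j
  · rfl
  · change some (Fin.rev _) = some _
    rw [Fin.rev_succAbove]
    cases s <;> simp [flip]

theorem mono_or_anti {k n : ℕ} {α : PT n} (hα : α ∈ POD n) {e : Fin k → Fin n} (he : StrictMono e)
    {g : Fin k → Fin n} (hg : ∀ x, α (e x) = some (g x)) : Monotone g ∨ Antitone g := by
  rcases hα with h | h
  · exact Or.inl fun x y hxy => h _ _ _ _ (hg x) (hg y) (he.monotone hxy)
  · exact Or.inr fun x y hxy => h _ _ _ _ (hg x) (hg y) (he.monotone hxy)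

theorem eq_one_or_γ_of_rank {n : ℕ} (α : POD n) (h : rank (α : PT n) = n) :
    α = 1 ∨ α = γ n := by
  obtain ⟨g, hg, hα, hr⟩ := exists_total_of_ncard (α : PT n) h
  have hu : Set.range g = Set.range (id : Fin n → Fin n) := by
    rw [Set.range_id, Set.range_eq_univ]
    exact Finite.surjective_of_injective hg
  obtain ⟨s, hs⟩ := exists_flip_of_range_eq hg (mono_or_anti α.2 strictMono_id hα) strictMono_id hu
  cases s
  · left
    refine Subtype.ext (funext fun x => ?_)
    rw [hα, hs]
    rfl
  · right
    refine Subtype.ext (funext fun x => ?_)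
    rw [hα, hs]
    rfl

/-- If `α` is total, its rank prevents injectivity, and a monotone or antitone map that is not
injective identifies two neighbours. Any other case has a missing point, which serves as both `i`
and `a`. -/
theorem exists_factor_proj {α : PT (m + 1)} (hα : α ∈ POD (m + 1)) (hJ : α ∈ J (m + 1)) :
    ∃ (r : RowIndex m) (a : Fin (m + 1)), ∀ x,
      α x = (r.proj x).bind (fun j => α (a.succAbove j)) := by
  by_cases hn : ∃ i, α i = none
  · obtain ⟨i, hi⟩ := hn
    refine ⟨miss i, i, fun x => ?_⟩
    rcases eq_or_ne x i with rfl | h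
    · simp [proj, hi]
    · obtain ⟨j, rfl⟩ := Fin.exists_succAbove_eq h
      simp [proj]
  · have ht : ∀ x, ∃ y, α x = some y := by
      push Not at hn
      exact fun x => Option.ne_none_iff_exists'.1 (hn x)
    choose h hh using ht
    have hni : ¬ Function.Injective h := by
      intro hi
      have him : im α = Set.univ := by
        refine Set.eq_univ_of_forall fun y => ?_
        obtain ⟨x, rfl⟩ := Finite.surjective_of_injective hi y
        exact ⟨x, hh x⟩
      have hc : (im α).ncard = m := hJ
      rw [him, Set.ncard_univ, Nat.card_eq_fintype_card, Fintype.card_fin] at hc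
      omega
    have hex : ∃ i : Fin m, h i.castSucc = h i.succ := by
      by_contra hne
      push Not at hne
      refine hni ?_
      rcases mono_or_anti hα strictMono_id hh with hm | hm
      · exact (Fin.strictMono_iff_lt_succ.2 fun i =>
          lt_of_le_of_ne (hm (Fin.castSucc_lt_succ (i := i)).le) (hne i)).injective
      · exact (Fin.strictAnti_iff_succ_lt.2 fun i =>
          lt_of_le_of_ne (hm (Fin.castSucc_lt_succ (i := i)).le) (hne i).symm).injective
    obtain ⟨i, hi⟩ := hex
    refine ⟨glue i, i.succ, fun x => ?_⟩
    simp only [proj, Option.bind_some]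
    rcases eq_or_ne x i.succ with rfl | hx
    · rw [Fin.predAbove_succ_self, hh, ← hi, ← hh]
      congr 1
      exact (Fin.succAbove_succ_self i).symm
    · rw [Fin.succ_succAbove_predAbove hx]

/-- Every element of rank `n - 1` has the form `elt r l s`. -/
theorem exists_eq_elt (α : POD (m + 1)) (hJ : (α : PT (m + 1)) ∈ J (m + 1)) :
    ∃ r l s, α = elt r l s := by
  obtain ⟨r, a, hr⟩ := exists_factor_proj α.2 hJ
  obtain ⟨c, hc⟩ := r.exists_compat
  have him : {y | ∃ x, (α : PT (m + 1)) (a.succAbove x) = some y} = im (α : PT (m + 1)) := by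
    ext y
    constructor
    · rintro ⟨x, hx⟩
      exact ⟨_, hx⟩
    · rintro ⟨x, hx⟩
      rw [hr] at hx
      obtain ⟨j, -, hj⟩ := Option.bind_eq_some_iff.1 hx
      exact ⟨j, hj⟩
  have hcard : (im (α : PT (m + 1))).ncard = m := hJ
  obtain ⟨g, hg, hα, hrange⟩ := exists_total_of_ncard
    (fun j => (α : PT (m + 1)) (a.succAbove j)) (by rw [him]; exact hcard)
  rw [him] at hrange
  have hl : ∃ l, im (α : PT (m + 1)) = {l}ᶜ := by
    have h1 : ((im (α : PT (m + 1)))ᶜ).ncard = 1 := by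
      rw [Set.ncard_compl, hcard]
      simp
    obtain ⟨l, hl⟩ := Set.ncard_eq_one.1 h1
    exact ⟨l, by rw [← hl, compl_compl]⟩
  obtain ⟨l, hl⟩ := hl
  obtain ⟨s, hs⟩ := exists_flip_of_range_eq hg
    (mono_or_anti α.2 (Fin.strictMono_succAbove a) hα) (Fin.strictMono_succAbove l)
    (by rw [hrange, hl, Fin.range_succAbove])
  refine ⟨r, l, s, Subtype.ext (funext fun x => ?_)⟩
  rw [hr, elt_apply]
  rcases r.proj x with _ | j
  · rfl
  · simp only [Option.bind_some, Option.map_some]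
    rw [hα, hs]

/-! ### Generation by the elements of rank `n - 1` and the reversal -/

/-- A monotone total map as an element of `POD n`. -/
def ofMono {n : ℕ} (f : Fin n → Fin n) (hf : Monotone f) : POD n :=
  ⟨fun x => some (f x), by
    left
    intro x y a b hx hy h
    obtain rfl : f x = a := Option.some.inj hx
    obtain rfl : f y = b := Option.some.inj hy
    exact hf h⟩

/-- The total displacement of a map. -/
def displacement {n : ℕ} (f : Fin n → Fin n) : ℕ :=
  -- Subtraction is truncated, so each summand is the distance between `x` and `f x`.
  ∑ x : Fin n, (((x : ℕ) - f x) + ((f x : ℕ) - x))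

/-- Let j be the largest point moved up. Then j + 1 is not moved up, so monotonicity forces j and j
+ 1 both to have value j + 1. The first point of that fibre is the required `i`. -/
theorem exists_push {f : Fin (m + 1) → Fin (m + 1)} (hf : Monotone f) (h : ∃ x, x < f x) :
    ∃ i : Fin m, f i.castSucc = f i.succ ∧ i.castSucc < f i.castSucc ∧
      ∀ y < i.castSucc, f y < f i.castSucc := by
  have hS : (Finset.univ.filter fun x => x < f x).Nonempty := by
    obtain ⟨x, hx⟩ := h
    exact ⟨x, by simpa using hx⟩
  obtain ⟨x, hx, hmax⟩ := Finset.exists_max_image _ id hS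
  simp only [Finset.mem_filter, Finset.mem_univ, true_and, id] at hx hmax
  have hxm : (x : ℕ) < m := by
    have := (f x).isLt
    have := Fin.lt_def.1 hx
    omega
  obtain ⟨j, rfl⟩ : ∃ j : Fin m, j.castSucc = x := ⟨⟨x, hxm⟩, rfl⟩
  have h1 : f j.succ ≤ j.succ := by
    by_contra hc
    exact absurd (hmax _ (not_le.1 hc)) (not_le.2 Fin.castSucc_lt_succ)
  have h2 : f j.castSucc ≤ f j.succ := hf Fin.castSucc_lt_succ.le
  have h3 : j.succ ≤ f j.castSucc := Fin.castSucc_lt_iff_succ_le.1 hx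
  have h4 : f j.castSucc = j.succ := le_antisymm (h2.trans h1) h3
  have h5 : f j.succ = j.succ := le_antisymm h1 (h3.trans h2)
  have hS' : (Finset.univ.filter fun y => f y = j.succ).Nonempty := ⟨j.succ, by simpa using h5⟩
  obtain ⟨y, hy, hmin⟩ := Finset.exists_min_image _ id hS'
  simp only [Finset.mem_filter, Finset.mem_univ, true_and, id] at hy hmin
  have hyj : y ≤ j.castSucc := hmin _ h4
  obtain ⟨i, rfl⟩ : ∃ i : Fin m, i.castSucc = y :=
    ⟨⟨y, lt_of_le_of_lt (Fin.le_def.1 hyj) hxm⟩, rfl⟩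
  have hij : i ≤ j := Fin.castSucc_le_castSucc_iff.1 hyj
  refine ⟨i, ?_, ?_, ?_⟩
  · refine le_antisymm (hf Fin.castSucc_lt_succ.le) ?_
    rw [hy]
    exact (hf (Fin.succ_le_succ_iff.2 hij)).trans h5.le
  · rw [hy]
    exact Fin.castSucc_lt_succ_iff.2 hij
  · intro z hz
    refine lt_of_le_of_ne (hf hz.le) fun he => ?_
    exact absurd (hmin z (he.trans hy)) (not_le.2 hz)

/-- The left factor sends i to i + 1 and fixes all other points. As `f` agrees on i and i + 1, the
value of the right factor at i is free; lowering it by one keeps monotonicity, because i is first in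
its fibre, and decreases the displacement, because i is moved up. -/
theorem exists_factor_of_lt {f : Fin (m + 1) → Fin (m + 1)} (hf : Monotone f)
    (h : ∃ x, x < f x) :
    ∃ (i : Fin m) (g : Fin (m + 1) → Fin (m + 1)) (hg : Monotone g),
      displacement g < displacement f ∧
      ofMono f hf = elt (glue i) i.castSucc false * ofMono g hg := by
  obtain ⟨i, hi, hlt, hfirst⟩ := exists_push hf h
  have hlt' : (i : ℕ) < (f i.castSucc : ℕ) := Fin.lt_def.1 hlt
  obtain ⟨w, hw⟩ : ∃ w : Fin (m + 1), (w : ℕ) + 1 = f i.castSucc :=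
    ⟨⟨(f i.castSucc : ℕ) - 1, by omega⟩, by simp; omega⟩
  have hgi : Function.update f i.castSucc w i.castSucc = w := Function.update_self ..
  have hgo : ∀ x, x ≠ i.castSucc → Function.update f i.castSucc w x = f x := fun x hx =>
    Function.update_of_ne hx ..
  refine ⟨i, Function.update f i.castSucc w, ?_, ?_, ?_⟩
  · intro x y hxy
    rcases eq_or_ne x i.castSucc with rfl | hx <;> rcases eq_or_ne y i.castSucc with rfl | hy
    · exact le_rfl
    · rw [hgi, hgo y hy, Fin.le_def]
      have := Fin.le_def.1 (hf hxy)
      omega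
    · rw [hgi, hgo x hx, Fin.le_def]
      have := Fin.lt_def.1 (hfirst x (lt_of_le_of_ne hxy hx))
      omega
    · rw [hgo x hx, hgo y hy]
      exact hf hxy
  · refine Finset.sum_lt_sum (fun x _ => ?_) ⟨i.castSucc, Finset.mem_univ _, ?_⟩
    · rcases eq_or_ne x i.castSucc with rfl | hx
      · rw [hgi]
        simp only [Fin.val_castSucc]
        omega
      · rw [hgo x hx]
    · rw [hgi]
      simp only [Fin.val_castSucc]
      omega
  · refine Subtype.ext (funext fun x => ?_)
    change some (f x) = some (Function.update f i.castSucc w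
      (i.castSucc.succAbove (i.predAbove x)))
    rcases eq_or_ne x i.castSucc with rfl | hx
    · rw [Fin.predAbove_castSucc_self, Fin.succAbove_castSucc_self,
        hgo _ (Fin.castSucc_lt_succ (i := i)).ne', hi]
    · rw [Fin.succAbove_predAbove hx, hgo x hx]

theorem one_mem_of_γ_mem {n : ℕ} {T : Subsemigroup (POD n)} (hγ : γ n ∈ T) : 1 ∈ T :=
  γ_mul_γ n ▸ T.mul_mem hγ hγ

theorem displacement_conj {n : ℕ} (f : Fin n → Fin n) :
    displacement (fun x => (f x.rev).rev) = displacement f := by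
  unfold displacement
  rw [← Equiv.sum_comp Fin.revPerm]
  refine Finset.sum_congr rfl fun x _ => ?_
  simp only [Fin.revPerm_apply, Fin.rev_rev, Fin.val_rev]
  omega

/-- Induction on displacement. If no point is moved up but some point is moved down, conjugation by
the reversal gives a map of equal displacement that moves a point up. -/
theorem ofMono_mem {T : Subsemigroup (POD (m + 1))} (hγ : γ (m + 1) ∈ T)
    (hJ : ∀ r l s, elt r l s ∈ T) (k : ℕ) :
    ∀ (f : Fin (m + 1) → Fin (m + 1)) (hf : Monotone f), displacement f = k → ofMono f hf ∈ T := by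
  induction k using Nat.strong_induction_on with
  | _ k ih =>
    have key : ∀ (f : Fin (m + 1) → Fin (m + 1)) (hf : Monotone f), displacement f = k →
        (∃ x, x < f x) → ofMono f hf ∈ T := by
      intro f hf hk hx
      obtain ⟨i, g, hg, hlt, he⟩ := exists_factor_of_lt hf hx
      rw [he]
      exact T.mul_mem (hJ _ _ _) (ih _ (hk ▸ hlt) g hg rfl)
    intro f hf hk
    by_cases hx : ∃ x, x < f x
    · exact key f hf hk hx
    by_cases hx' : ∃ x, f x < x
    · obtain ⟨x, hx'⟩ := hx'
      have hg : Monotone (fun x : Fin (m + 1) => (f x.rev).rev) := fun x y h =>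
        Fin.rev_le_rev.2 (hf (Fin.rev_le_rev.2 h))
      have hgT := key _ hg ((displacement_conj f).trans hk)
        ⟨x.rev, by rw [Fin.rev_rev]; exact Fin.rev_lt_rev.2 hx'⟩
      have he : ofMono f hf = γ (m + 1) * ofMono _ hg * γ (m + 1) := by
        refine Subtype.ext (funext fun x => ?_)
        change some (f x) = some ((f x.rev.rev).rev).rev
        rw [Fin.rev_rev, Fin.rev_rev]
      rw [he]
      exact T.mul_mem (T.mul_mem hγ hgT) hγ
    · have he : ofMono f hf = 1 := by
        refine Subtype.ext (funext fun x => congrArg some ?_)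
        exact le_antisymm (not_lt.1 fun h => hx ⟨x, h⟩) (not_lt.1 fun h => hx' ⟨x, h⟩)
      rw [he]
      exact one_mem_of_γ_mem hγ

/-- The partial identity with domain the complement of `s`. -/
def partialId {n : ℕ} (s : Finset (Fin n)) : POD n :=
  ⟨fun x => if x ∈ s then none else some x, by
    left
    intro x y a b hx hy h
    simp only [Option.ite_none_left_eq_some] at hx hy
    obtain rfl : x = a := Option.some.inj hx.2
    obtain rfl : y = b := Option.some.inj hy.2
    exact h⟩

theorem partialId_mem {T : Subsemigroup (POD (m + 1))} (hγ : γ (m + 1) ∈ T)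
    (hJ : ∀ r l s, elt r l s ∈ T) (s : Finset (Fin (m + 1))) : partialId s ∈ T := by
  induction s using Finset.induction_on with
  | empty =>
    have : partialId (∅ : Finset (Fin (m + 1))) = 1 := by
      refine Subtype.ext (funext fun x => ?_)
      change (if x ∈ (∅ : Finset (Fin (m + 1))) then none else some x) = some x
      exact if_neg (Finset.notMem_empty x)
    rw [this]
    exact one_mem_of_γ_mem hγ
  | insert a s ha ih =>
    have : partialId (insert a s) = elt (miss a) a false * partialId s := by
      refine Subtype.ext (funext fun x => ?_)
      change (if x ∈ insert a s then none else some x) =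
        ((finSuccEquiv' a x).map (fun j => a.succAbove j)).bind _
      rcases eq_or_ne x a with rfl | hx
      · rw [if_pos (Finset.mem_insert_self x s), finSuccEquiv'_at]
        rfl
      · obtain ⟨j, rfl⟩ := Fin.exists_succAbove_eq hx
        simp only [finSuccEquiv'_succAbove, Option.map_some, Finset.mem_insert, hx, false_or]
        rfl
    rw [this]
    exact T.mul_mem (hJ _ _ _) ih

theorem exists_eq_partialId_mul_ofMono (α : POD (m + 1)) (h : OrderPreserving (α : PT (m + 1))) :
    ∃ s f hf, α = partialId s * ofMono f hf := by
  classical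
  -- A monotone total extension: the largest value attained so far. Undefined points contribute the
  -- bottom element 0 and so do not affect the supremum.
  let F : Fin (m + 1) → Fin (m + 1) := fun x =>
    (Finset.Iic x).sup fun y => ((α : PT (m + 1)) y).getD 0
  have hF : Monotone F := fun x y hxy =>
    Finset.sup_mono (Finset.Iic_subset_Iic.2 hxy)
  refine ⟨Finset.univ.filter fun x => (α : PT (m + 1)) x = none, F, hF,
    Subtype.ext (funext fun x => ?_)⟩
  change _ = (if x ∈ Finset.univ.filter (fun x => (α : PT (m + 1)) x = none) then none
    else some x).bind fun x => some (F x)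
  rcases hx : (α : PT (m + 1)) x with _ | a
  · simp [hx]
  · rw [if_neg (by simp [hx])]
    refine congrArg some (le_antisymm ?_ (Finset.sup_le fun y hy => ?_))
    · have := Finset.le_sup (f := fun y => ((α : PT (m + 1)) y).getD 0)
        (Finset.mem_Iic.2 (le_refl x))
      simpa [hx] using this
    · rcases hy' : (α : PT (m + 1)) y with _ | b
      · exact Fin.zero_le _
      · exact h y x b a hy' hx (Finset.mem_Iic.1 hy)

/-- An order-preserving element is a restriction of a monotone total map; an order-reversing one
becomes order-preserving after right multiplication by the reversal, an involution. -/
theorem eq_top_of_J_subset {T : Subsemigroup (POD (m + 1))} (hγ : γ (m + 1) ∈ T)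
    (hJ : ∀ r l s, elt r l s ∈ T) : T = ⊤ := by
  have key : ∀ α : POD (m + 1), OrderPreserving (α : PT (m + 1)) → α ∈ T := by
    intro α hα
    obtain ⟨s, f, hf, rfl⟩ := exists_eq_partialId_mul_ofMono α hα
    exact T.mul_mem (partialId_mem hγ hJ s) (ofMono_mem hγ hJ _ f hf rfl)
  refine eq_top_iff.2 fun α _ => ?_
  rcases α.2 with h | h
  · exact key α h
  · have h1 : α * γ (m + 1) ∈ T := by
      refine key _ ?_
      intro x y a b hx hy hxy
      obtain ⟨x', hx1, hx2⟩ := (mul_eq_some _ _ x a).1 hx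
      obtain ⟨y', hy1, hy2⟩ := (mul_eq_some _ _ y b).1 hy
      obtain rfl : x'.rev = a := Option.some.inj hx2
      obtain rfl : y'.rev = b := Option.some.inj hy2
      exact Fin.rev_le_rev.2 (h _ _ _ _ hx1 hy1 hxy)
    have h2 := T.mul_mem h1 hγ
    rwa [mul_assoc, γ_mul_γ, mul_one] at h2

/-! ### Rows and rectangles -/

theorem rank_one {n : ℕ} : rank (1 : PT n) = n := by
  have : im (1 : PT n) = Set.univ := Set.eq_univ_of_forall fun x => ⟨x, rfl⟩
  rw [rank, this, Set.ncard_univ, Nat.card_eq_fintype_card, Fintype.card_fin]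

theorem rank_γ {n : ℕ} : rank (γ n : PT n) = n := by
  have : im (γ n : PT n) = Set.univ :=
    Set.eq_univ_of_forall fun x => ⟨x.rev, by rw [γ_apply, Fin.rev_rev]⟩
  rw [rank, this, Set.ncard_univ, Nat.card_eq_fintype_card, Fintype.card_fin]

theorem one_notMem_J : ((1 : POD (m + 1)) : PT (m + 1)) ∉ J (m + 1) := fun h => by
  have h1 : rank (1 : PT (m + 1)) = m := h
  rw [rank_one] at h1
  omega

theorem γ_notMem_J : (γ (m + 1) : PT (m + 1)) ∉ J (m + 1) := fun h => by
  have h1 : rank (γ (m + 1) : PT (m + 1)) = m := h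
  rw [rank_γ] at h1
  omega

/-- With `le_rank_of_mul_mem_J`, this lists all possible factors of a product of rank m, so that
closure under products becomes a short case check. -/
theorem cases_of_le_rank (α : POD (m + 1)) (h : m ≤ rank (α : PT (m + 1))) :
    α = 1 ∨ α = γ (m + 1) ∨ ∃ r l s, α = elt r l s := by
  rcases (rank_le (α : PT (m + 1))).eq_or_lt with h1 | h1
  · rcases eq_one_or_γ_of_rank α h1 with h2 | h2
    · exact Or.inl h2
    · exact Or.inr (Or.inl h2)
  · have h2 : rank (α : PT (m + 1)) = m + 1 - 1 := by omega
    exact Or.inr (Or.inr (exists_eq_elt α h2))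

theorem le_rank_of_mul_mem_J {α β : POD (m + 1)}
    (h : ((α * β : POD (m + 1)) : PT (m + 1)) ∈ J (m + 1)) :
    m ≤ rank (α : PT (m + 1)) ∧ m ≤ rank (β : PT (m + 1)) := by
  have h' : rank ((α : PT (m + 1)) * (β : PT (m + 1))) = m := h
  exact ⟨h'.ge.trans (rank_mul_le_left _ _), h'.ge.trans (rank_mul_le_right _ _)⟩

/-- The elements of rank `n - 1` with kernel `r`. -/
def Row (r : RowIndex m) : Set (POD (m + 1)) := {α | ∃ l s, α = elt r l s}

theorem elt_mem_Row {r r' : RowIndex m} {l : Fin (m + 1)} {s : Bool} :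
    elt r l s ∈ Row r' ↔ r = r' := by
  constructor
  · rintro ⟨l', s', h⟩
    exact (elt_inj h).1
  · rintro rfl
    exact ⟨l, s, rfl⟩

theorem γ_mul_mem_Row {r : RowIndex m} {α : POD (m + 1)} (h : α ∈ Row r) :
    γ (m + 1) * α ∈ Row r.rev := by
  obtain ⟨l, s, rfl⟩ := h
  exact ⟨_, _, γ_mul_elt r l s⟩

theorem γ_mul_γ_mul (α : POD (m + 1)) : γ (m + 1) * (γ (m + 1) * α) = α := by
  rw [← mul_assoc, γ_mul_γ, one_mul]

theorem elt_mul_mem_Row {r : RowIndex m} {l : Fin (m + 1)} {s : Bool} {t : POD (m + 1)}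
    (h : ((elt r l s * t : POD (m + 1)) : PT (m + 1)) ∈ J (m + 1)) : elt r l s * t ∈ Row r := by
  rcases cases_of_le_rank t (le_rank_of_mul_mem_J h).2 with rfl | rfl | ⟨r', l', s', rfl⟩
  · exact ⟨l, s, mul_one _⟩
  · exact ⟨_, _, elt_mul_γ r l s⟩
  · exact ⟨_, _, elt_mul_elt (compat_of_mul_mem_J h)⟩

theorem mem_J_of_mem_Row {r : RowIndex m} {α : POD (m + 1)} (h : α ∈ Row r) :
    (α : PT (m + 1)) ∈ J (m + 1) := by
  obtain ⟨l, s, rfl⟩ := h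
  exact elt_mem_J r l s

/-- The elements outside the rows of the kernels `r` and `r.rev`. -/
def rowCompl (r : RowIndex m) : Subsemigroup (POD (m + 1)) where
  carrier := (Row r ∪ Row r.rev)ᶜ
  mul_mem' := by
    intro α β hα hβ h
    have hJ : ((α * β : POD (m + 1)) : PT (m + 1)) ∈ J (m + 1) := by
      rcases h with h | h <;> exact mem_J_of_mem_Row h
    rcases cases_of_le_rank α (le_rank_of_mul_mem_J hJ).1 with rfl | rfl | ⟨r', l', s', rfl⟩
    · rw [one_mul] at h
      exact hβ h
    · refine hβ ?_
      rcases h with h | h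
      · right
        have := γ_mul_mem_Row h
        rwa [γ_mul_γ_mul] at this
      · left
        have := γ_mul_mem_Row h
        rwa [γ_mul_γ_mul, rev_rev] at this
    · obtain ⟨l, s, he⟩ := elt_mul_mem_Row hJ
      rw [he] at h
      refine hα ?_
      rcases h with h | h
      · exact Or.inl (elt_mem_Row.2 (elt_mem_Row.1 h))
      · exact Or.inr (elt_mem_Row.2 (elt_mem_Row.1 h))

/-- The rectangle of a set `B` of columns: the elements whose column lies in `B` or whose row is
compatible with no column in `B`, together with all elements of rank other than `n - 1`. -/
def rect (B : Set (Fin (m + 1))) : Set (POD (m + 1)) :=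
  {α | (α : PT (m + 1)) ∉ J (m + 1) ∨
    ∃ r l s, α = elt r l s ∧ (l ∈ B ∨ ∀ l' ∈ B, ¬ Compat l' r)}

theorem elt_mem_rect {B : Set (Fin (m + 1))} {r : RowIndex m} {l : Fin (m + 1)} {s : Bool} :
    elt r l s ∈ rect B ↔ l ∈ B ∨ ∀ l' ∈ B, ¬ Compat l' r := by
  constructor
  · rintro (h | ⟨r', l', s', h, h'⟩)
    · exact absurd (elt_mem_J r l s) h
    · obtain ⟨rfl, rfl⟩ := elt_inj h
      exact h'
  · exact fun h => Or.inr ⟨r, l, s, rfl, h⟩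

/-- A row with a missing point is compatible with one column only, so these rows suffice to recover
`B` from its rectangle. -/
theorem elt_miss_mem_rect {B : Set (Fin (m + 1))} {k l : Fin (m + 1)} {s : Bool} :
    elt (miss k) l s ∈ rect B ↔ l ∈ B ∨ k ∉ B := by
  rw [elt_mem_rect]
  refine or_congr Iff.rfl ⟨fun h hk => h k hk rfl, ?_⟩
  rintro h l' hl' rfl
  exact h hl'

/-- For two factors of rank m with product of rank m, the column of the left one is compatible with
the row of the right one. If that column is in `B`, the right factor must have its column in `B`;
otherwise the row of the left factor avoids `B`, and the product keeps this row. Invariance of `B`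
under reversal handles factors γ. -/
def rectSub (B : Set (Fin (m + 1))) (hB : ∀ l ∈ B, l.rev ∈ B) : Subsemigroup (POD (m + 1)) where
  carrier := rect B
  mul_mem' := by
    intro α β hα hβ
    by_cases hJ : ((α * β : POD (m + 1)) : PT (m + 1)) ∈ J (m + 1)
    swap
    · exact Or.inl hJ
    obtain ⟨h1, h2⟩ := le_rank_of_mul_mem_J hJ
    rcases cases_of_le_rank α h1 with rfl | rfl | ⟨r, l, s, rfl⟩
    · rwa [one_mul]
    · rcases cases_of_le_rank β h2 with rfl | rfl | ⟨r', l', s', rfl⟩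
      · rwa [mul_one]
      · rw [γ_mul_γ] at hJ
        exact absurd hJ one_notMem_J
      · rw [γ_mul_elt, elt_mem_rect]
        rw [elt_mem_rect] at hβ
        refine hβ.imp id fun h k hk hc => h k.rev (hB k hk) ?_
        rw [← compat_rev, Fin.rev_rev]
        exact hc
    · rcases cases_of_le_rank β h2 with rfl | rfl | ⟨r', l', s', rfl⟩
      · rwa [mul_one]
      · rw [elt_mul_γ, elt_mem_rect]
        rw [elt_mem_rect] at hα
        exact hα.imp (hB l) id
      · have hc := compat_of_mul_mem_J hJ
        rw [elt_mul_elt hc, elt_mem_rect]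
        rw [elt_mem_rect] at hα hβ
        rcases hα with hα | hα
        · rcases hβ with hβ | hβ
          · exact Or.inl hβ
          · exact absurd hc (hβ l hα)
        · exact Or.inr hα

theorem eq_of_rect_subset {B B' : Set (Fin (m + 1))} (h1 : B'.Nonempty) (h2 : B' ≠ Set.univ)
    (h : rect B ⊆ rect B') : B = B' := by
  have key : ∀ k l, (l ∈ B ∨ k ∉ B) → l ∈ B' ∨ k ∉ B' := fun k l hkl =>
    elt_miss_mem_rect.1 (h (elt_miss_mem_rect (s := false).2 hkl))
  obtain ⟨a, ha⟩ := h1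
  obtain ⟨b, hb⟩ := (Set.ne_univ_iff_exists_notMem _).1 h2
  ext l
  constructor
  · intro hl
    exact (key a l (Or.inl hl)).resolve_right (not_not.2 ha)
  · intro hl
    by_contra hl'
    exact (key l b (Or.inr hl')).elim hb (not_not.2 hl)

/-- A proper subsemigroup containing the reversal and an element of every row lies in a proper rectangle. -/
theorem exists_subset_rect (hm : 0 < m) {T : Subsemigroup (POD (m + 1))} (hγ : γ (m + 1) ∈ T)
    (hT : T ≠ ⊤) (hrow : ∀ r : RowIndex m, ∃ l s, elt r l s ∈ T) :
    ∃ B : Set (Fin (m + 1)), (∀ l ∈ B, l.rev ∈ B) ∧ B.Nonempty ∧ B ≠ Set.univ ∧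
      (T : Set (POD (m + 1))) ⊆ rect B := by
  by_contra hno
  push Not at hno
  have hall : ∀ r l, ∃ s, elt r l s ∈ T := by
    intro r l
    let X : Set (Fin (m + 1)) := {l | ∃ s, elt r l s ∈ T}
    have h1 : ∀ l ∈ X, l.rev ∈ X := by
      rintro l ⟨s, hs⟩
      exact ⟨!s, elt_mul_γ r l s ▸ T.mul_mem hs hγ⟩
    have h2 : X.Nonempty := hrow r
    have h3 : (T : Set (POD (m + 1))) ⊆ rect X := by
      intro α hα
      by_cases hJ : (α : PT (m + 1)) ∈ J (m + 1)
      swap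
      · exact Or.inl hJ
      obtain ⟨r', l', s', rfl⟩ := exists_eq_elt α hJ
      rw [elt_mem_rect]
      by_cases hc : ∃ k ∈ X, Compat k r'
      · obtain ⟨k, ⟨s, hs⟩, hc⟩ := hc
        exact Or.inl ⟨s ^^ s', elt_mul_elt hc ▸ T.mul_mem hs hα⟩
      · push Not at hc
        exact Or.inr hc
    have h4 : X = Set.univ := by
      by_contra h4
      exact hno X h1 h2 h4 h3
    have h5 : l ∈ X := h4 ▸ Set.mem_univ l
    exact h5
  refine hT (eq_top_of_J_subset hγ fun r l s => ?_)
  -- The middle column and its reversal are both compatible with the middle glued row. Passing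
  -- through one or the other yields products with the same row and column but opposite signs.
  let i : Fin m := ⟨m / 2, Nat.div_lt_self hm one_lt_two⟩
  have hc : Compat i.castSucc (glue i) := Or.inl rfl
  have hc' : Compat i.castSucc.rev (glue i) := by
    have : m - m / 2 = m / 2 ∨ m - m / 2 = m / 2 + 1 := by omega
    refine this.imp (fun h => ?_) (fun h => ?_) <;>
    · refine Fin.ext ?_
      simp only [Fin.val_rev, Fin.val_castSucc, Fin.val_succ, i]
      omega
  obtain ⟨s1, h1⟩ := hall r i.castSucc
  obtain ⟨s2, h2⟩ := hall (glue i) l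
  have h3 : elt r i.castSucc.rev (!s1) ∈ T := elt_mul_γ r _ s1 ▸ T.mul_mem h1 hγ
  have h4 := T.mul_mem h1 h2
  have h5 := T.mul_mem h3 h2
  rw [elt_mul_elt hc] at h4
  rw [elt_mul_elt hc'] at h5
  cases s <;> cases s1 <;> cases s2 <;> simp_all

/-! ### Classification of the maximal subsemigroups -/

theorem γ_mem_rectSub {B : Set (Fin (m + 1))} (hB : ∀ l ∈ B, l.rev ∈ B) :
    γ (m + 1) ∈ rectSub B hB := Or.inl γ_notMem_J

theorem γ_mem_rowCompl (r : RowIndex m) : γ (m + 1) ∈ rowCompl r := by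
  rintro (h | h) <;> exact γ_notMem_J (mem_J_of_mem_Row h)

theorem rectSub_ne_top {B : Set (Fin (m + 1))} (hB : ∀ l ∈ B, l.rev ∈ B) (h1 : B.Nonempty)
    (h2 : B ≠ Set.univ) : rectSub B hB ≠ ⊤ := by
  intro h
  obtain ⟨a, ha⟩ := h1
  obtain ⟨b, hb⟩ := (Set.ne_univ_iff_exists_notMem _).1 h2
  have h3 : elt (miss a) b false ∈ rectSub B hB := h ▸ Subsemigroup.mem_top _
  exact (elt_miss_mem_rect.1 h3).elim hb (not_not.2 ha)

theorem rowCompl_ne_top (r : RowIndex m) : rowCompl r ≠ ⊤ := by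
  intro h
  have h3 : elt r 0 false ∈ rowCompl r := h ▸ Subsemigroup.mem_top _
  exact h3 (Or.inl (elt_mem_Row.2 rfl))

/-- The elements other than the reversal. -/
def γCompl (m : ℕ) : Subsemigroup (POD (m + 1)) where
  carrier := {γ (m + 1)}ᶜ
  mul_mem' := by
    intro α β hα hβ h
    have h : α * β = γ (m + 1) := h
    have hr : rank ((α : PT (m + 1)) * (β : PT (m + 1))) = m + 1 :=
      (congrArg (fun δ : POD (m + 1) => rank (δ : PT (m + 1))) h).trans rank_γ
    have h1 := (rank_le _).antisymm (hr ▸ rank_mul_le_left (α : PT (m + 1)) (β : PT (m + 1)))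
    have h2 := (rank_le _).antisymm (hr ▸ rank_mul_le_right (α : PT (m + 1)) (β : PT (m + 1)))
    rcases eq_one_or_γ_of_rank α h1 with rfl | rfl
    · rcases eq_one_or_γ_of_rank β h2 with rfl | rfl
      · rw [mul_one] at h
        exact hα h
      · exact hβ rfl
    · exact hα rfl

theorem eq_of_isCoatom_of_le {S : Type*} [Semigroup S] {T U : Subsemigroup S} (hT : IsCoatom T)
    (h : T ≤ U) (hU : U ≠ ⊤) : U = T :=
  (hT.le_iff.1 h).resolve_left hU

theorem isCoatom_of_forall {S : Type*} [Semigroup S] {T : Subsemigroup S} (h : T ≠ ⊤)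
    (h' : ∀ U, T ≤ U → U ≠ ⊤ → U ≤ T) : IsCoatom T := by
  refine ⟨h, fun U hU => ?_⟩
  by_contra hne
  exact hU.not_ge (h' U hU.le hne)

theorem isCoatom_γCompl : IsCoatom (γCompl m) := by
  refine isCoatom_of_forall ?_ fun U hU hne α hα => ?_
  · intro h
    have : γ (m + 1) ∈ γCompl m := h ▸ Subsemigroup.mem_top _
    exact this rfl
  · rintro rfl
    refine hne (eq_top_iff.2 fun β _ => ?_)
    by_cases hβ : β = γ (m + 1)
    · rwa [hβ]
    · exact hU hβ

theorem isCoatom_rectSub (hm : 0 < m) {B : Set (Fin (m + 1))} (hB : ∀ l ∈ B, l.rev ∈ B)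
    (h1 : B.Nonempty) (h2 : B ≠ Set.univ) : IsCoatom (rectSub B hB) := by
  refine isCoatom_of_forall (rectSub_ne_top hB h1 h2) fun U hU hne => ?_
  obtain ⟨a, ha⟩ := h1
  obtain ⟨B', -, h1', h2', hU'⟩ := exists_subset_rect hm (hU (γ_mem_rectSub hB)) hne
    fun r => ⟨a, false, hU (elt_mem_rect.2 (Or.inl ha))⟩
  obtain rfl := eq_of_rect_subset h1' h2' (Set.Subset.trans hU hU')
  exact hU'

theorem exists_compat_glue (hm : 0 < m) (l : Fin (m + 1)) : ∃ i : Fin m, Compat l (glue i) := by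
  rcases Fin.eq_castSucc_or_eq_last l with ⟨i, rfl⟩ | rfl
  · exact ⟨i, Or.inl rfl⟩
  · exact ⟨⟨m - 1, by omega⟩, Or.inr (Fin.ext (by simp; omega))⟩

/-- For `a` in `B` and `b` outside, the rectangle omits column `b` of every row compatible with `a`.
Such rows include one with a missing point and a glued one, while a single orbit of rows has only
one of these types. -/
theorem not_rowCompl_subset_rect (hm : 0 < m) (r : RowIndex m) {B : Set (Fin (m + 1))}
    (h1 : B.Nonempty) (h2 : B ≠ Set.univ) : ¬ (rowCompl r : Set (POD (m + 1))) ⊆ rect B := by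
  intro h
  obtain ⟨a, ha⟩ := h1
  obtain ⟨b, hb⟩ := (Set.ne_univ_iff_exists_notMem _).1 h2
  have key : ∀ r', Compat a r' → r' = r ∨ r' = r.rev := by
    intro r' hc
    by_contra hne
    have h3 : elt r' b false ∈ rect B := by
      refine h ?_
      rintro (h4 | h4)
      · exact hne (Or.inl (elt_mem_Row.1 h4))
      · exact hne (Or.inr (elt_mem_Row.1 h4))
    rcases elt_mem_rect.1 h3 with h4 | h4
    · exact hb h4
    · exact h4 a ha hc
  obtain ⟨i, hi⟩ := exists_compat_glue hm a
  have k1 := key (miss a) rfl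
  have k2 := key (glue i) hi
  cases r <;> simp [RowIndex.rev] at k1 k2

theorem isCoatom_rowCompl (hm : 0 < m) (r : RowIndex m) : IsCoatom (rowCompl r) := by
  refine isCoatom_of_forall (rowCompl_ne_top r) fun U hU hne α hα => ?_
  intro hα'
  have hγ := hU (γ_mem_rowCompl r)
  obtain ⟨l, s, hr⟩ : ∃ l s, elt r l s ∈ U := by
    rcases hα' with ⟨l, s, rfl⟩ | ⟨l, s, rfl⟩
    · exact ⟨l, s, hα⟩
    · have := U.mul_mem hγ hα
      rw [γ_mul_elt, rev_rev] at this
      exact ⟨_, _, this⟩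
  have hr' := U.mul_mem hγ hr
  rw [γ_mul_elt] at hr'
  -- The extra element and its product with γ fill the two removed rows, so `U` meets every row.
  obtain ⟨B, -, h1, h2, hB⟩ := exists_subset_rect hm hγ hne fun r' => by
    by_cases h1 : r' = r
    · exact ⟨l, s, h1 ▸ hr⟩
    by_cases h2 : r' = r.rev
    · exact ⟨_, _, h2 ▸ hr'⟩
    refine ⟨0, false, hU ?_⟩
    rintro (h | h)
    · exact h1 (elt_mem_Row.1 h)
    · exact h2 (elt_mem_Row.1 h)
  exact not_rowCompl_subset_rect hm r h1 h2 (Set.Subset.trans hU hB)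

theorem isMaximalSubsemigroup_iff (hm : 0 < m) (X : Set (POD (m + 1))) :
    IsMaximalSubsemigroup X ↔
      X = {γ (m + 1)}ᶜ ∨
      (∃ B : Set (Fin (m + 1)), (∀ l ∈ B, l.rev ∈ B) ∧ B.Nonempty ∧ B ≠ Set.univ ∧ X = rect B) ∨
      ∃ r : RowIndex m, X = (Row r ∪ Row r.rev)ᶜ := by
  constructor
  · rintro ⟨T, hT, rfl⟩
    by_cases hγ : γ (m + 1) ∈ T
    swap
    · left
      have h1 : T ≤ γCompl m := by
        rintro α hα rfl
        exact hγ hα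
      rw [← eq_of_isCoatom_of_le hT h1 (isCoatom_γCompl).1]
      rfl
    right
    by_cases hrow : ∀ r : RowIndex m, ∃ l s, elt r l s ∈ T
    · left
      obtain ⟨B, hB, h1, h2, hTB⟩ := exists_subset_rect hm hγ hT.1 hrow
      refine ⟨B, hB, h1, h2, ?_⟩
      have h3 : T ≤ rectSub B hB := hTB
      rw [← eq_of_isCoatom_of_le hT h3 (rectSub_ne_top hB h1 h2)]
      rfl
    · right
      push Not at hrow
      obtain ⟨r, hr⟩ := hrow
      refine ⟨r, ?_⟩
      have h3 : T ≤ rowCompl r := by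
        rintro α hα (⟨l, s, rfl⟩ | ⟨l, s, rfl⟩)
        · exact hr l s hα
        · have := T.mul_mem hγ hα
          rw [γ_mul_elt, rev_rev] at this
          exact hr _ _ this
      rw [← eq_of_isCoatom_of_le hT h3 (rowCompl_ne_top r)]
      rfl
  · rintro (rfl | ⟨B, hB, h1, h2, rfl⟩ | ⟨r, rfl⟩)
    · exact ⟨_, isCoatom_γCompl, rfl⟩
    · exact ⟨_, isCoatom_rectSub hm hB h1 h2, rfl⟩
    · exact ⟨_, isCoatom_rowCompl hm r, rfl⟩

/-! ### Green's relation -/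

theorem self_mem_principalRightIdeal {S : Type*} [Semigroup S] (x : S) :
    x ∈ principalRightIdeal x := Or.inl rfl

/-- Right multiplication that preserves the rank changes only column and sign, and a right factor
with row `miss l'` turns column `l'` into any column, with any sign. -/
theorem setOf_greenR_elt (r : RowIndex m) (l : Fin (m + 1)) (s : Bool) :
    {y | GreenR y (elt r l s)} = Row r := by
  ext y
  constructor
  · intro h
    have h : principalRightIdeal y = principalRightIdeal (elt r l s) := h
    have h1 : y ∈ principalRightIdeal (elt r l s) := h ▸ self_mem_principalRightIdeal y
    have h2 : elt r l s ∈ principalRightIdeal y := h ▸ self_mem_principalRightIdeal _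
    rcases h1 with rfl | ⟨t, ht⟩
    · exact ⟨l, s, rfl⟩
    · have h3 : rank (elt r l s : PT (m + 1)) ≤ rank (y : PT (m + 1)) := by
        rcases h2 with h2 | ⟨u, hu⟩
        · rw [h2]
        · rw [hu]
          exact rank_mul_le_left _ _
      have h4 : rank (y : PT (m + 1)) ≤ rank (elt r l s : PT (m + 1)) := by
        rw [ht]
        exact rank_mul_le_left _ _
      rw [ht]
      refine elt_mul_mem_Row ?_
      rw [← ht]
      exact (h4.antisymm h3).trans (elt_mem_J r l s)
  · rintro ⟨l', s', rfl⟩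
    have key : ∀ l s l' s', principalRightIdeal (elt r l s) ⊆
        principalRightIdeal (elt r l' s') := by
      intro l s l' s' z hz
      have he : elt r l s = elt r l' s' * elt (miss l') l (s' ^^ s) := by
        rw [elt_mul_elt (r' := miss l') rfl, ← Bool.xor_assoc, Bool.xor_self, Bool.false_xor]
      rcases hz with rfl | ⟨t, rfl⟩
      · exact Or.inr ⟨_, he⟩
      · exact Or.inr ⟨_, by rw [he, mul_assoc]⟩
    exact (key _ _ _ _).antisymm (key _ _ _ _)

theorem isRemoveROrbit_iff (X : Set (POD (m + 1))) :
    IsRemoveROrbit (m + 1) X ↔ ∃ r : RowIndex m, X = (Row r ∪ Row r.rev)ᶜ := by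
  have himg : ∀ r : RowIndex m, (fun α => γ (m + 1) * α) '' Row r = Row r.rev := by
    intro r
    ext α
    constructor
    · rintro ⟨β, hβ, rfl⟩
      exact γ_mul_mem_Row hβ
    · intro hα
      refine ⟨γ (m + 1) * α, ?_, γ_mul_γ_mul α⟩
      have := γ_mul_mem_Row hα
      rwa [rev_rev] at this
  constructor
  · rintro ⟨C, ⟨x, rfl⟩, hJ, rfl⟩
    obtain ⟨r, l, s, rfl⟩ := exists_eq_elt x (hJ x rfl)
    refine ⟨r, ?_⟩
    rw [setOf_greenR_elt, himg]
  · rintro ⟨r, rfl⟩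
    refine ⟨Row r, ⟨elt r 0 false, (setOf_greenR_elt _ _ _).symm⟩,
      fun α hα => mem_J_of_mem_Row hα, ?_⟩
    rw [himg]

/-! ### Translation to indices in `{1, …, n}` -/

/-- The representative in `{1, …, ⌈n/2⌉}` of the orbit of a point under reversal. -/
def half (l : Fin (m + 1)) : ℕ := min (l + 1) (m + 1 - l)

/-- The representative in `{1, …, ⌊n/2⌋}` of the orbit of a pair of neighbours under reversal. -/
def halfGlue (b : Fin m) : ℕ := min (b + 1) (m - b)

theorem half_mem (l : Fin (m + 1)) : half l ∈ Finset.Icc 1 ((m + 1 + 1) / 2) := by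
  rw [Finset.mem_Icc, half]
  omega

theorem halfGlue_mem (b : Fin m) : halfGlue b ∈ Finset.Icc 1 ((m + 1) / 2) := by
  rw [Finset.mem_Icc, halfGlue]
  omega

theorem exists_half_eq {i : ℕ} (hi : i ∈ Finset.Icc 1 ((m + 1 + 1) / 2)) :
    ∃ l : Fin (m + 1), half l = i := by
  rw [Finset.mem_Icc] at hi
  refine ⟨⟨i - 1, by omega⟩, ?_⟩
  simp only [half]
  omega

theorem exists_halfGlue_eq {i : ℕ} (hi : i ∈ Finset.Icc 1 ((m + 1) / 2)) :
    ∃ b : Fin m, halfGlue b = i := by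
  rw [Finset.mem_Icc] at hi
  refine ⟨⟨i - 1, by omega⟩, ?_⟩
  simp only [halfGlue]
  omega

theorem half_eq_half {l l' : Fin (m + 1)} : half l = half l' ↔ l = l' ∨ l = l'.rev := by
  simp only [half, Fin.ext_iff, Fin.val_rev]
  omega

theorem halfGlue_eq_halfGlue {b b' : Fin m} : halfGlue b = halfGlue b' ↔ b = b' ∨ b = b'.rev := by
  simp only [halfGlue, Fin.ext_iff, Fin.val_rev]
  omega

/-- The bounds matter: for an index outside {1, …, n} the condition on the image is vacuous. -/
theorem elt_mem_L {r : RowIndex m} {l : Fin (m + 1)} {s : Bool} {i : ℕ} (h1 : 1 ≤ i)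
    (h2 : i ≤ m + 1) : (elt r l s : PT (m + 1)) ∈ L (m + 1) i ↔ (l : ℕ) + 1 = i := by
  constructor
  · rintro ⟨-, h⟩
    have := h ⟨i - 1, by omega⟩ (by simp; omega)
    rw [im_elt, Set.notMem_compl_iff, Set.mem_singleton_iff] at this
    rw [← this]
    simp only
    omega
  · intro h
    refine ⟨elt_mem_J r l s, fun x hx => ?_⟩
    rw [im_elt, Set.notMem_compl_iff, Set.mem_singleton_iff]
    exact Fin.ext (by omega)

theorem elt_mem_R {r : RowIndex m} {l : Fin (m + 1)} {s : Bool} {i : ℕ} (h1 : 1 ≤ i)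
    (h2 : i ≤ m + 1) :
    (elt r l s : PT (m + 1)) ∈ R (m + 1) i ↔ ∃ a, r = miss a ∧ (a : ℕ) + 1 = i := by
  have hd : ∀ x, x ∉ dom (elt r l s : PT (m + 1)) ↔ r = miss x := fun x => by
    rw [← proj_eq_none, ← elt_eq_none (l := l) (s := s)]
    exact Option.eq_none_iff_forall_ne_some.trans (not_exists).symm |>.symm
  constructor
  · rintro ⟨-, h⟩
    exact ⟨⟨i - 1, by omega⟩, (hd _).1 (h _ (by simp; omega)), by simp; omega⟩
  · rintro ⟨a, hr, ha⟩
    refine ⟨elt_mem_J r l s, fun x hx => ?_⟩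
    obtain rfl : x = a := Fin.ext (by omega)
    exact (hd x).2 hr

theorem elt_mem_RPair {r : RowIndex m} {l : Fin (m + 1)} {s : Bool} {i : ℕ} :
    (elt r l s : PT (m + 1)) ∈ RPair (m + 1) i (i + 1) ↔
      ∃ b, r = glue b ∧ (b : ℕ) + 1 = i := by
  have hk : ∀ b : Fin m, (b.castSucc, b.succ) ∈ ker (elt r l s : PT (m + 1)) ↔ r = glue b := by
    intro b
    rw [← proj_eq_some_both]
    constructor
    · rintro ⟨z, h1, h2⟩
      have h3 := elt_eq_iff.1 (h1.trans h2.symm)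
      obtain ⟨w, hw, -⟩ := Option.map_eq_some_iff.1 h1
      exact ⟨w, hw, h3 ▸ hw⟩
    · rintro ⟨w, h1, h2⟩
      refine ⟨l.succAbove (flip s w), ?_, ?_⟩
      · change (r.proj _).map _ = _
        rw [h1]
        rfl
      · change (r.proj _).map _ = _
        rw [h2]
        rfl
  constructor
  · rintro ⟨-, x, y, hx, hy, hxy⟩
    have hlt : (x : ℕ) < m := by omega
    obtain ⟨b, rfl⟩ : ∃ b : Fin m, b.castSucc = x := ⟨⟨x, hlt⟩, rfl⟩
    obtain rfl : b.succ = y := Fin.ext (by simp only [Fin.val_succ, Fin.val_castSucc] at *; omega)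
    exact ⟨b, (hk b).1 hxy, hx⟩
  · rintro ⟨b, hr, hb⟩
    exact ⟨elt_mem_J r l s, b.castSucc, b.succ, hb, by simp [hb], (hk b).2 hr⟩

theorem elt_mem_L_union {r : RowIndex m} {l : Fin (m + 1)} {s : Bool} {i : ℕ}
    (hi : i ∈ Finset.Icc 1 ((m + 1 + 1) / 2)) :
    (elt r l s : PT (m + 1)) ∈ L (m + 1) i ∪ L (m + 1) (m + 1 - i + 1) ↔ half l = i := by
  rw [Finset.mem_Icc] at hi
  rw [Set.mem_union, elt_mem_L (by omega) (by omega), elt_mem_L (by omega) (by omega), half]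
  omega

theorem elt_mem_R_union {r : RowIndex m} {l : Fin (m + 1)} {s : Bool} {i : ℕ}
    (hi : i ∈ Finset.Icc 1 ((m + 1 + 1) / 2)) :
    (elt r l s : PT (m + 1)) ∈ R (m + 1) i ∪ R (m + 1) (m + 1 - i + 1) ↔
      ∃ a, r = miss a ∧ half a = i := by
  rw [Finset.mem_Icc] at hi
  rw [Set.mem_union, elt_mem_R (by omega) (by omega), elt_mem_R (by omega) (by omega),
    ← exists_or]
  refine exists_congr fun a => ?_
  rw [← and_or_left, half]
  refine and_congr Iff.rfl ?_
  omega

theorem elt_mem_RPair_union {r : RowIndex m} {l : Fin (m + 1)} {s : Bool} {i : ℕ}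
    (hi : i ∈ Finset.Icc 1 ((m + 1) / 2)) :
    (elt r l s : PT (m + 1)) ∈
        RPair (m + 1) i (i + 1) ∪ RPair (m + 1) (m + 1 - i) (m + 1 - i + 1) ↔
      ∃ b, r = glue b ∧ halfGlue b = i := by
  rw [Finset.mem_Icc] at hi
  rw [Set.mem_union, elt_mem_RPair, elt_mem_RPair, ← exists_or]
  refine exists_congr fun b => ?_
  rw [← and_or_left, halfGlue]
  refine and_congr Iff.rfl ?_
  omega

/-- A glued row is compatible with two neighbouring columns. Their orbit representatives are i and i
+ 1 with i the representative of the row, except at the middle pair, which is its own reversal. -/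
theorem rectangle_eq_rect {A : Finset ℕ} (hA : A ⊆ Finset.Icc 1 ((m + 1 + 1) / 2)) :
    rectangle (m + 1) A = rect {l | half l ∈ A} := by
  have hA' : ∀ i, (m + 1 + 1) / 2 < i → i ∉ A := fun i hi h =>
    absurd (Finset.mem_Icc.1 (hA h)).2 (not_le.2 hi)
  ext α
  by_cases hJ : (α : PT (m + 1)) ∈ J (m + 1)
  swap
  · exact ⟨fun _ => Or.inl hJ, fun _ => Or.inl hJ⟩
  obtain ⟨r, l, s, rfl⟩ := exists_eq_elt α hJ
  rw [elt_mem_rect]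
  have h0 : (elt r l s ∈ rectangle (m + 1) A) ↔ (∃ i ∈ A, half l = i) ∨
      (∃ i ∈ Finset.Icc 1 ((m + 1 + 1) / 2), i ∉ A ∧ ∃ a, r = miss a ∧ half a = i) ∨
      (∃ i ∈ Finset.Icc 1 ((m + 1) / 2), i ∉ A ∧ i + 1 ∉ A ∧ ∃ b, r = glue b ∧ halfGlue b = i) := by
    refine (or_iff_right (not_not.2 hJ)).trans (or_congr ?_ (or_congr ?_ ?_))
    · exact exists_congr fun i => and_congr_right fun hi => elt_mem_L_union (hA hi)
    · exact exists_congr fun i => and_congr_right fun hi => and_congr_right fun _ =>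
        elt_mem_R_union hi
    · exact exists_congr fun i => and_congr_right fun hi => and_congr_right fun _ =>
        and_congr_right fun _ => elt_mem_RPair_union hi
  rw [h0]
  refine or_congr ⟨?_, fun h => ⟨_, h, rfl⟩⟩ ?_
  · rintro ⟨i, hi, rfl⟩
    exact hi
  cases r with
  | miss a =>
    constructor
    · rintro (⟨i, -, hiA, a', ha, rfl⟩ | ⟨i, -, -, -, b, hb, -⟩)
      · cases ha
        rintro _ hl' rfl
        exact hiA hl'
      · cases hb
    · intro h
      exact Or.inl ⟨half a, half_mem a, fun ha => h a ha rfl, a, rfl, rfl⟩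
  | glue b =>
    have hh : (half b.castSucc ∉ A ∧ half b.succ ∉ A) ↔ (halfGlue b ∉ A ∧ halfGlue b + 1 ∉ A) := by
      have hb := b.isLt
      simp only [half, halfGlue, Fin.val_castSucc, Fin.val_succ]
      rcases lt_trichotomy ((b : ℕ) + 1) (m - b) with h | h | h
      · rw [min_eq_left (by omega), min_eq_left (by omega), min_eq_left (by omega)]
      · rw [min_eq_left (by omega), min_eq_right (by omega), min_eq_left (by omega),
          show m + 1 - ((b : ℕ) + 1) = b + 1 by omega]
        -- The middle pair, for even n: both columns have representative n/2, and n/2 + 1 lies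
        -- outside the index range, so the second condition is automatic.
        exact and_congr_right fun _ => ⟨fun _ => hA' _ (by omega), fun _ => by assumption⟩
      · rw [min_eq_right (by omega), min_eq_right (by omega), min_eq_right (by omega),
          show m + 1 - ((b : ℕ) + 1) = m - b by omega, show m + 1 - (b : ℕ) = m - b + 1 by omega]
        exact and_comm
    constructor
    · rintro (⟨i, -, hiA, a', ha, rfl⟩ | ⟨i, -, h1, h2, b', hb, rfl⟩)
      · cases ha
      · cases hb
        have := hh.2 ⟨h1, h2⟩
        rintro l' hl' (rfl | rfl)
        · exact this.1 hl'
        · exact this.2 hl'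
    · intro h
      have := hh.1 ⟨fun h1 => h _ h1 (Or.inl rfl), fun h1 => h _ h1 (Or.inr rfl)⟩
      exact Or.inr ⟨halfGlue b, halfGlue_mem b, this.1, this.2, b, rfl, rfl⟩

theorem half_rev (l : Fin (m + 1)) : half l.rev = half l := half_eq_half.2 (Or.inr rfl)

theorem exists_rect_iff (X : Set (POD (m + 1))) :
    (∃ B : Set (Fin (m + 1)), (∀ l ∈ B, l.rev ∈ B) ∧ B.Nonempty ∧ B ≠ Set.univ ∧ X = rect B) ↔
      ∃ A : Finset ℕ, A.Nonempty ∧ A ⊂ Finset.Icc 1 ((m + 1 + 1) / 2) ∧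
        X = rectangle (m + 1) A := by
  classical
  constructor
  · rintro ⟨B, hB, ⟨b, hb⟩, h2, rfl⟩
    obtain ⟨c, hc⟩ := (Set.ne_univ_iff_exists_notMem _).1 h2
    let A : Finset ℕ := Finset.univ.filter (fun l => l ∈ B) |>.image half
    have hmem : ∀ l, half l ∈ A ↔ l ∈ B := by
      intro l
      simp only [A, Finset.mem_image, Finset.mem_filter, Finset.mem_univ, true_and]
      constructor
      · rintro ⟨l', hl', he⟩
        rcases half_eq_half.1 he.symm with rfl | rfl
        · exact hl'
        · exact hB _ hl'
      · exact fun h => ⟨l, h, rfl⟩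
    have hA : A ⊆ Finset.Icc 1 ((m + 1 + 1) / 2) := by
      intro i hi
      obtain ⟨l, -, rfl⟩ := Finset.mem_image.1 hi
      exact half_mem l
    refine ⟨A, ⟨_, (hmem b).2 hb⟩, (Finset.ssubset_iff_of_subset hA).2
      ⟨half c, half_mem c, fun h => hc ((hmem c).1 h)⟩, ?_⟩
    rw [rectangle_eq_rect hA]
    congr 1
    ext l
    exact (hmem l).symm
  · rintro ⟨A, ⟨i, hi⟩, hA, rfl⟩
    refine ⟨{l | half l ∈ A}, fun l hl => ?_, ?_, ?_, rectangle_eq_rect hA.1⟩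
    · change half l.rev ∈ A
      rw [half_rev]
      exact hl
    · obtain ⟨l, rfl⟩ := exists_half_eq (hA.1 hi)
      exact ⟨l, hi⟩
    · obtain ⟨j, hj, hjA⟩ := (Finset.ssubset_iff_of_subset hA.1).1 hA
      obtain ⟨l, rfl⟩ := exists_half_eq hj
      exact (Set.ne_univ_iff_exists_notMem _).2 ⟨l, hjA⟩

/-- The elements outside the orbit of the `i`-th row of non-total elements. -/
def missCompl (n i : ℕ) : Set (POD n) := {α | (α : PT n) ∉ R n i ∪ R n (n - i + 1)}

/-- The elements outside the orbit of the `i`-th row of total elements. -/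
def glueCompl (n i : ℕ) : Set (POD n) :=
  {α | (α : PT n) ∉ RPair n i (i + 1) ∪ RPair n (n - i) (n - i + 1)}

theorem eq_of_elt_mem_iff {X Y : Set (POD (m + 1))}
    (hX : ∀ α : POD (m + 1), (α : PT (m + 1)) ∉ J (m + 1) → α ∈ X)
    (hY : ∀ α : POD (m + 1), (α : PT (m + 1)) ∉ J (m + 1) → α ∈ Y)
    (h : ∀ r l s, elt r l s ∈ X ↔ elt r l s ∈ Y) : X = Y := by
  ext α
  by_cases hJ : (α : PT (m + 1)) ∈ J (m + 1)
  · obtain ⟨r, l, s, rfl⟩ := exists_eq_elt α hJ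
    exact h r l s
  · exact ⟨fun _ => hY α hJ, fun _ => hX α hJ⟩

theorem mem_missCompl_of_notMem_J {n i : ℕ} {α : POD n} (h : (α : PT n) ∉ J n) :
    α ∈ missCompl n i := by
  rintro (h' | h') <;> exact h h'.1

theorem mem_glueCompl_of_notMem_J {n i : ℕ} {α : POD n} (h : (α : PT n) ∉ J n) :
    α ∈ glueCompl n i := by
  rintro (h' | h') <;> exact h h'.1

theorem rowCompl_miss (a : Fin (m + 1)) :
    (Row (miss a) ∪ Row (miss a).rev)ᶜ = missCompl (m + 1) (half a) := by
  refine eq_of_elt_mem_iff ?_ (fun α => mem_missCompl_of_notMem_J) fun r l s => ?_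
  · rintro α hα (h | h) <;> exact hα (mem_J_of_mem_Row h)
  · refine not_congr ?_
    rw [elt_mem_R_union (half_mem a), Set.mem_union, elt_mem_Row, elt_mem_Row]
    constructor
    · rintro (rfl | rfl)
      · exact ⟨a, rfl, rfl⟩
      · exact ⟨a.rev, rfl, half_rev a⟩
    · rintro ⟨b, rfl, hb⟩
      rcases half_eq_half.1 hb with rfl | rfl
      · exact Or.inl rfl
      · exact Or.inr rfl

theorem rowCompl_glue (a : Fin m) :
    (Row (glue a) ∪ Row (glue a).rev)ᶜ = glueCompl (m + 1) (halfGlue a) := by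
  refine eq_of_elt_mem_iff ?_ (fun α => mem_glueCompl_of_notMem_J) fun r l s => ?_
  · rintro α hα (h | h) <;> exact hα (mem_J_of_mem_Row h)
  · refine not_congr ?_
    rw [elt_mem_RPair_union (halfGlue_mem a), Set.mem_union, elt_mem_Row, elt_mem_Row]
    constructor
    · rintro (rfl | rfl)
      · exact ⟨a, rfl, rfl⟩
      · exact ⟨a.rev, rfl, halfGlue_eq_halfGlue.2 (Or.inr rfl)⟩
    · rintro ⟨b, rfl, hb⟩
      rcases halfGlue_eq_halfGlue.1 hb with rfl | rfl
      · exact Or.inl rfl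
      · exact Or.inr rfl

theorem exists_rowCompl_iff (X : Set (POD (m + 1))) :
    (∃ r : RowIndex m, X = (Row r ∪ Row r.rev)ᶜ) ↔
      (∃ i ∈ Finset.Icc 1 ((m + 1 + 1) / 2), X = missCompl (m + 1) i) ∨
      ∃ i ∈ Finset.Icc 1 ((m + 1) / 2), X = glueCompl (m + 1) i := by
  constructor
  · rintro ⟨a | a, rfl⟩
    · exact Or.inl ⟨half a, half_mem a, rowCompl_miss a⟩
    · exact Or.inr ⟨halfGlue a, halfGlue_mem a, rowCompl_glue a⟩
  · rintro (⟨i, hi, rfl⟩ | ⟨i, hi, rfl⟩)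
    · obtain ⟨a, rfl⟩ := exists_half_eq hi
      exact ⟨miss a, (rowCompl_miss a).symm⟩
    · obtain ⟨a, rfl⟩ := exists_halfGlue_eq hi
      exact ⟨glue a, (rowCompl_glue a).symm⟩

/-! ### Counting -/

theorem elt_miss_mem_missCompl {a l : Fin (m + 1)} {s : Bool} {i : ℕ}
    (hi : i ∈ Finset.Icc 1 ((m + 1 + 1) / 2)) :
    elt (miss a) l s ∈ missCompl (m + 1) i ↔ half a ≠ i := by
  refine not_congr ((elt_mem_R_union hi).trans ⟨?_, fun h => ⟨a, rfl, h⟩⟩)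
  rintro ⟨b, hb, h⟩
  cases hb
  exact h

theorem elt_miss_mem_glueCompl {a l : Fin (m + 1)} {s : Bool} {i : ℕ}
    (hi : i ∈ Finset.Icc 1 ((m + 1) / 2)) :
    elt (miss a) l s ∈ glueCompl (m + 1) i := by
  refine (not_congr (elt_mem_RPair_union hi)).2 ?_
  rintro ⟨b, hb, -⟩
  cases hb

theorem elt_glue_mem_glueCompl {b : Fin m} {l : Fin (m + 1)} {s : Bool} {i : ℕ}
    (hi : i ∈ Finset.Icc 1 ((m + 1) / 2)) :
    elt (glue b) l s ∈ glueCompl (m + 1) i ↔ halfGlue b ≠ i := by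
  refine not_congr ((elt_mem_RPair_union hi).trans ⟨?_, fun h => ⟨b, rfl, h⟩⟩)
  rintro ⟨b, hb, h⟩
  cases hb
  exact h

theorem injOn_missCompl : Set.InjOn (missCompl (m + 1)) (Finset.Icc 1 ((m + 1 + 1) / 2)) := by
  intro i hi j hj h
  obtain ⟨a, rfl⟩ := exists_half_eq hi
  by_contra hne
  have h1 : elt (miss a) 0 false ∈ missCompl (m + 1) j := (elt_miss_mem_missCompl hj).2 hne
  exact (elt_miss_mem_missCompl hi).1 (h.symm ▸ h1) rfl

theorem injOn_glueCompl : Set.InjOn (glueCompl (m + 1)) (Finset.Icc 1 ((m + 1) / 2)) := by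
  intro i hi j hj h
  obtain ⟨a, rfl⟩ := exists_halfGlue_eq hi
  by_contra hne
  have h1 : elt (glue a) 0 false ∈ glueCompl (m + 1) j := (elt_glue_mem_glueCompl hj).2 hne
  exact (elt_glue_mem_glueCompl hi).1 (h.symm ▸ h1) rfl

/-- Removing glued rows keeps every row with a missing point, so the two families cannot share a
set. -/
theorem disjoint_missCompl_glueCompl :
    Disjoint (missCompl (m + 1) '' (Finset.Icc 1 ((m + 1 + 1) / 2)))
      (glueCompl (m + 1) '' (Finset.Icc 1 ((m + 1) / 2))) := by
  rw [Set.disjoint_left]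
  rintro _ ⟨i, hi, rfl⟩ ⟨j, hj, h⟩
  obtain ⟨a, rfl⟩ := exists_half_eq hi
  exact (elt_miss_mem_missCompl hi).1 (h ▸ elt_miss_mem_glueCompl (l := 0) (s := false) hj) rfl

/-- The index sets of the proper rectangles. -/
def rectangleIndices (c : ℕ) : Finset (Finset ℕ) := (Finset.Icc 1 c).ssubsets.erase ∅

theorem mem_rectangleIndices {c : ℕ} {A : Finset ℕ} :
    A ∈ rectangleIndices c ↔ A.Nonempty ∧ A ⊂ Finset.Icc 1 c := by
  rw [rectangleIndices, Finset.mem_erase, Finset.mem_ssubsets, Finset.nonempty_iff_ne_empty]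

theorem card_rectangleIndices {c : ℕ} (hc : 1 ≤ c) : (rectangleIndices c).card = 2 ^ c - 2 := by
  have h0 : (∅ : Finset ℕ) ∈ (Finset.Icc 1 c).ssubsets := by
    rw [Finset.mem_ssubsets, Finset.empty_ssubset]
    exact ⟨1, Finset.mem_Icc.2 ⟨le_rfl, hc⟩⟩
  rw [rectangleIndices, Finset.card_erase_of_mem h0, Finset.ssubsets,
    Finset.card_erase_of_mem (Finset.mem_powerset_self _), Finset.card_powerset, Nat.card_Icc]
  simp only [Nat.add_sub_cancel]
  omega

theorem injOn_rectangle :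
    Set.InjOn (rectangle (m + 1)) (rectangleIndices ((m + 1 + 1) / 2)) := by
  intro A hA A' hA' h
  obtain ⟨-, hA⟩ := mem_rectangleIndices.1 hA
  obtain ⟨⟨i, hi⟩, hA'⟩ := mem_rectangleIndices.1 hA'
  rw [rectangle_eq_rect hA.1, rectangle_eq_rect hA'.1] at h
  have h1 : {l : Fin (m + 1) | half l ∈ A'}.Nonempty := by
    obtain ⟨l, rfl⟩ := exists_half_eq (hA'.1 hi)
    exact ⟨l, hi⟩
  have h2 : {l : Fin (m + 1) | half l ∈ A'} ≠ Set.univ := by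
    obtain ⟨j, hj, hjA⟩ := (Finset.ssubset_iff_of_subset hA'.1).1 hA'
    obtain ⟨l, rfl⟩ := exists_half_eq hj
    exact (Set.ne_univ_iff_exists_notMem _).2 ⟨l, hjA⟩
  have h3 := eq_of_rect_subset h1 h2 h.le
  ext j
  by_cases hj : j ∈ Finset.Icc 1 ((m + 1 + 1) / 2)
  · obtain ⟨l, rfl⟩ := exists_half_eq hj
    exact Set.ext_iff.1 h3 l
  · exact ⟨fun h => absurd (hA.1 h) hj, fun h => absurd (hA'.1 h) hj⟩

theorem exists_elt_mem_rectangle {A : Finset ℕ} (hA : A ∈ rectangleIndices ((m + 1 + 1) / 2)) :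
    ∃ l, ∀ r : RowIndex m, elt r l false ∈ rectangle (m + 1) A := by
  obtain ⟨⟨i, hi⟩, hA⟩ := mem_rectangleIndices.1 hA
  obtain ⟨l, rfl⟩ := exists_half_eq (hA.1 hi)
  refine ⟨l, fun r => ?_⟩
  rw [rectangle_eq_rect hA.1]
  exact elt_mem_rect.2 (Or.inl hi)

/-- A rectangle with non-empty index set meets every row, whereas each row complement misses one. -/
theorem disjoint_rectangle :
    Disjoint (rectangle (m + 1) '' (rectangleIndices ((m + 1 + 1) / 2)))
      (missCompl (m + 1) '' (Finset.Icc 1 ((m + 1 + 1) / 2)) ∪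
        glueCompl (m + 1) '' (Finset.Icc 1 ((m + 1) / 2))) := by
  rw [Set.disjoint_left]
  rintro _ ⟨A, hA, rfl⟩ h
  obtain ⟨l, hl⟩ := exists_elt_mem_rectangle hA
  rcases h with ⟨i, hi, h⟩ | ⟨i, hi, h⟩
  · obtain ⟨a, rfl⟩ := exists_half_eq hi
    exact (elt_miss_mem_missCompl hi).1 (h.symm ▸ hl (miss a)) rfl
  · obtain ⟨a, rfl⟩ := exists_halfGlue_eq hi
    exact (elt_glue_mem_glueCompl hi).1 (h.symm ▸ hl (glue a)) rfl

theorem setOf_isMaximalSubsemigroup (hm : 0 < m) :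
    {X : Set (POD (m + 1)) | IsMaximalSubsemigroup X} =
      insert {γ (m + 1)}ᶜ (rectangle (m + 1) '' (rectangleIndices ((m + 1 + 1) / 2)) ∪
        (missCompl (m + 1) '' (Finset.Icc 1 ((m + 1 + 1) / 2)) ∪
          glueCompl (m + 1) '' (Finset.Icc 1 ((m + 1) / 2)))) := by
  ext X
  refine (isMaximalSubsemigroup_iff hm X).trans (or_congr Iff.rfl (or_congr ?_ ?_))
  · rw [exists_rect_iff]
    refine exists_congr fun A => ?_
    rw [Finset.mem_coe, mem_rectangleIndices, and_assoc]
    exact and_congr_right fun _ => and_congr_right fun _ => eq_comm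
  · rw [exists_rowCompl_iff]
    refine or_congr ?_ ?_ <;> exact exists_congr fun i => and_congr_right fun _ => eq_comm

theorem ncard_isMaximalSubsemigroup (hm : 0 < m) :
    {X : Set (POD (m + 1)) | IsMaximalSubsemigroup X}.ncard =
      2 ^ ((m + 1 + 1) / 2) + (m + 1) - 1 := by
  rw [setOf_isMaximalSubsemigroup hm, Set.ncard_insert_of_notMem,
    Set.ncard_union_eq disjoint_rectangle, Set.ncard_union_eq disjoint_missCompl_glueCompl,
    injOn_rectangle.ncard_image, injOn_missCompl.ncard_image, injOn_glueCompl.ncard_image]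
  · simp only [Set.ncard_coe_finset, Nat.card_Icc]
    rw [card_rectangleIndices (by omega)]
    -- The total is 1 + (2 ^ c - 2) + c + ⌊n/2⌋ with c = ⌈n/2⌉; this bound makes the truncated
    -- subtraction exact.
    have : 2 ^ 1 ≤ 2 ^ ((m + 1 + 1) / 2) := Nat.pow_le_pow_right two_pos (by omega)
    omega
  · have key : ∀ X : Set (POD (m + 1)), γ (m + 1) ∈ X → X ≠ {γ (m + 1)}ᶜ := by
      rintro X hX rfl
      exact hX rfl
    rintro (⟨A, -, h⟩ | ⟨i, -, h⟩ | ⟨i, -, h⟩)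
    · exact key _ (Or.inl γ_notMem_J) h
    · exact key _ (mem_missCompl_of_notMem_J γ_notMem_J) h
    · exact key _ (mem_glueCompl_of_notMem_J γ_notMem_J) h

/-! ### Degree one -/

theorem POD_one : POD 1 = ⊤ := by
  refine eq_top_iff.2 fun α _ => Or.inl fun x y a b _ _ _ => ?_
  exact (Subsingleton.elim a b).le

theorem card_POD_one : Nat.card (POD 1) = 2 := by
  rw [POD_one]
  have h : Nat.card (⊤ : Submonoid (PT 1)) = Nat.card (PT 1) :=
    Nat.card_congr Submonoid.topEquiv.toEquiv
  have h' : Nat.card (PT 1) = Nat.card (Fin 1 → Option (Fin 1)) := rfl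
  rw [h, h']
  simp

theorem PT_one_mul_apply (α β : PT 1) (x : Fin 1) :
    (α * β) x = if α 0 = none ∨ β 0 = none then none else some 0 := by
  rw [mul_apply, Subsingleton.elim x 0]
  rcases hα : α 0 with _ | a
  · rw [if_pos (Or.inl rfl)]
    rfl
  · change β a = _
    rw [Subsingleton.elim a 0]
    rcases β 0 with _ | b
    · simp
    · simp [Subsingleton.elim b 0]

theorem POD_one_mul_comm (x y : POD 1) : x * y = y * x := by
  refine Subtype.ext (funext fun i => ?_)
  change ((x : PT 1) * (y : PT 1)) i = ((y : PT 1) * (x : PT 1)) i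
  simp only [PT_one_mul_apply, or_comm]

theorem POD_one_mul_self (x : POD 1) : x * x = x := by
  refine Subtype.ext (funext fun i => ?_)
  change ((x : PT 1) * (x : PT 1)) i = (x : PT 1) i
  rw [PT_one_mul_apply, Subsingleton.elim i 0]
  rcases (x : PT 1) 0 with _ | a
  · simp
  · simp [Subsingleton.elim a 0]

theorem isMaximalSubsemigroup_iff_of_card_eq_two {S : Type*} [Semigroup S] (hc : Nat.card S = 2)
    (hi : ∀ x : S, x * x = x) (X : Set S) : IsMaximalSubsemigroup X ↔ ∃ x, X = {x} := by
  have htwo : ∀ x : S, ∃ y, y ≠ x ∧ ∀ z, z ≠ x → z = y := fun x =>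
    (Nat.card_eq_two_iff' x).1 hc
  let sing : S → Subsemigroup S := fun x =>
    { carrier := {x}
      mul_mem' := by
        rintro _ _ rfl rfl
        exact hi _ }
  have hne : ∀ x, sing x ≠ ⊤ := by
    intro x h
    obtain ⟨y, hy, -⟩ := htwo x
    have : y ∈ sing x := h ▸ Subsemigroup.mem_top y
    exact hy this
  have hco : ∀ x, IsCoatom (sing x) := by
    intro x
    refine isCoatom_of_forall (hne x) fun U hU hU' z hz => ?_
    by_contra hzx
    obtain ⟨y, -, hy⟩ := htwo x
    refine hU' (eq_top_iff.2 fun w _ => ?_)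
    by_cases hw : w = x
    · exact hU hw
    · rwa [hy w hw, ← hy z hzx]
  constructor
  · rintro ⟨T, hT, rfl⟩
    obtain ⟨y, hy⟩ : ∃ y, y ∉ T := by
      by_contra h
      push Not at h
      exact hT.1 (eq_top_iff.2 fun z _ => h z)
    obtain ⟨x, -, hx⟩ := htwo y
    -- This also disposes of the empty subsemigroup, which is not maximal because it lies properly
    -- in a singleton.
    have h1 : T ≤ sing x := fun z hz => hx z (by rintro rfl; exact hy hz)
    refine ⟨x, ?_⟩
    rw [← eq_of_isCoatom_of_le hT h1 (hne x)]
    rfl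
  · rintro ⟨x, rfl⟩
    exact ⟨sing x, hco x, rfl⟩

theorem isMaximalSubsemigroup_POD_one_iff (X : Set (POD 1)) :
    IsMaximalSubsemigroup X ↔ ∃ x, X = {x} :=
  isMaximalSubsemigroup_iff_of_card_eq_two card_POD_one POD_one_mul_self X

theorem ncard_isMaximalSubsemigroup_one :
    {X : Set (POD 1) | IsMaximalSubsemigroup X}.ncard = 2 := by
  have h : {X : Set (POD 1) | IsMaximalSubsemigroup X} = (fun x => {x}) '' Set.univ := by
    ext X
    rw [Set.mem_ofPred_eq, isMaximalSubsemigroup_POD_one_iff]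
    simp [eq_comm]
  rw [h, Set.ncard_image_of_injective _ Set.singleton_injective, Set.ncard_univ, card_POD_one]

end PartialTrans

theorem mainTheorem7 :
    (∀ n : ℕ, 2 ≤ n →
      -- the maximal subsemigroups
      (∀ X : Set (PartialTrans.POD n), PartialTrans.IsMaximalSubsemigroup X ↔
        (X = {PartialTrans.γ n}ᶜ ∨
         (∃ A : Finset ℕ, A.Nonempty ∧ A ⊂ Finset.Icc 1 ((n + 1) / 2) ∧
            X = PartialTrans.rectangle n A) ∨
         PartialTrans.IsRemoveROrbit n X)) ∧
      -- the members of the last family, explicitly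
      (∀ X : Set (PartialTrans.POD n), PartialTrans.IsRemoveROrbit n X ↔
        ((∃ i ∈ Finset.Icc 1 ((n + 1) / 2),
            X = {α : PartialTrans.POD n | (α : PartialTrans.PT n) ∉
              PartialTrans.R n i ∪ PartialTrans.R n (n - i + 1)}) ∨
         (∃ i ∈ Finset.Icc 1 (n / 2),
            X = {α : PartialTrans.POD n | (α : PartialTrans.PT n) ∉
              PartialTrans.RPair n i (i + 1) ∪ PartialTrans.RPair n (n - i) (n - i + 1)})))) ∧
    -- degree one
    (PartialTrans.POD 1 = ⊤ ∧ Nat.card (PartialTrans.POD 1) = 2 ∧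
      (∀ x y : PartialTrans.POD 1, x * y = y * x) ∧
      (∀ x : PartialTrans.POD 1, x * x = x) ∧
      (∀ X : Set (PartialTrans.POD 1), PartialTrans.IsMaximalSubsemigroup X ↔ ∃ x, X = {x})) ∧
    -- the number of maximal subsemigroups
    (∀ n : ℕ, 1 ≤ n →
      {X : Set (PartialTrans.POD n) | PartialTrans.IsMaximalSubsemigroup X}.ncard =
        2 ^ ((n + 1) / 2) + n - 1) 
:= by
  refine ⟨fun n hn => ?_, ⟨PartialTrans.POD_one, PartialTrans.card_POD_one,
    PartialTrans.POD_one_mul_comm, PartialTrans.POD_one_mul_self,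
    PartialTrans.isMaximalSubsemigroup_POD_one_iff⟩, fun n hn => ?_⟩
  · obtain ⟨m, rfl⟩ : ∃ m, n = m + 1 := ⟨n - 1, by omega⟩
    have hm : 0 < m := by omega
    refine ⟨fun X => ?_, fun X => ?_⟩
    · rw [PartialTrans.isMaximalSubsemigroup_iff hm, PartialTrans.exists_rect_iff,
        PartialTrans.isRemoveROrbit_iff]
    · rw [PartialTrans.isRemoveROrbit_iff]
      exact PartialTrans.exists_rowCompl_iff X
  · obtain ⟨m, rfl⟩ : ∃ m, n = m + 1 := ⟨n - 1, by omega⟩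
    rcases Nat.eq_zero_or_pos m with rfl | hm
    · exact PartialTrans.ncard_isMaximalSubsemigroup_one
    · exact PartialTrans.ncard_isMaximalSubsemigroup hm
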